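/- Notation. Let $d\in\mathbb{N}$ and, for $\xi\in\mathbb{R}^d$, let $\langle\xi\rangle=(1+|\xi|^2)^{1/2}$ with $|\cdot|$ the Euclidean norm. For $y\in\mathbb{R}^d$ let $e_y(x)=e^{2\pi i\,y\cdot x}$. For $x_0\in\mathbb{R}^d$ and $\eta>0$ let $I_{\eta,x_0}=\prod_{j=1}^d(x_{0,j}-\eta/2,\;x_{0,j}+\eta/2)$. For an open set $U\subseteq\mathbb{R}^d$, $\mathcal{D}(U)$ is the space of smooth complex-valued functions with compact support in $U$, and $\mathcal{D}'(\mathbb{R}^d)$ is the space of distributions on $\mathbb{R}^d$. An open cone is an open set $\Gamma\subseteq\mathbb{R}^d$ with $t\xi\in\Gamma$ for all $\xi\in\Gamma$, $t>0$. For $\varphi\in\mathcal{D}(\mathbb{R}^d)$ and $f\in\mathcal{D}'(\mathbb{R}^d)$, the Fourier transform of the compactly supported distribution $\varphi f$ is the function $\widehat{\varphi f}(\xi)=\langle f,\varphi\, e_{-\xi}\rangle$, and its periodic extension is the distribution $(\varphi f)_p=\sum_{n\in\mathbb{Z}^d}(\varphi f)(\,\cdot+n)\in\mathcal{D}'(\mathbb{R}^d)$.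 Sobolev wave front set. Let $f\in\mathcal{D}'(\mathbb{R}^d)$, $s\in\mathbb{R}$, $x_0\in\mathbb{R}^d$ and $\xi_0\in\mathbb{R}^d\setminus\{0\}$. Then $(x_0,\xi_0)\notin WF_s(f)$ means that there are an open cone $\Gamma\ni\xi_0$ and $\psi\in\mathcal{D}(\mathbb{R}^d)$ with $\psi\equiv1$ in a neighborhood of $x_0$ such that $\int_\Gamma|\widehat{\psi f}(\xi)|^2\langle\xi\rangle^{2s}\,d\xi<\infty$. Theorem. Let $f\in\mathcal{D}'(\mathbb{R}^d)$, $s\in\mathbb{R}$, $x_0\in\mathbb{R}^d$ and $\xi_0\in\mathbb{R}^d\setminus\{0\}$. Then $(x_0,\xi_0)\notin WF_s(f)$ if and only if there are an open cone $\Gamma\ni\xi_0$, a number $\eta\in(0,1)$ and a function $\varphi\in\mathcal{D}(I_{\eta,x_0})$ with $\varphi\equiv1$ in a neighborhood of $x_0$ such that $$\sum_{n\in\Gamma\cap\mathbb{Z}^d}|a_n|^2\langle n\rangle^{2s}<\infty,\qquad\text{where }(\varphi f)_p=\sum_{n\in\mathbb{Z}^d}a_n e_n \text{ in } \mathcal{D}'(\mathbb{R}^d).$$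 -/

import Mathlib

open Set Filter Topology TopologicalSpace MeasureTheory
open scoped Distributions ContDiff

noncomputable section

namespace SobolevWF

/-- The Euclidean space `ℝ^d`. -/
abbrev Eu (d : ℕ) : Type := EuclideanSpace ℝ (Fin d)

/-- `𝒟(ℝ^d)`: smooth compactly supported complex-valued functions, with the canonical LF
topology. -/
abbrev Test (d : ℕ) : Type := 𝓓((⊤ : Opens (Eu d)), ℂ)

/-- `𝒟'(ℝ^d)`: continuous `ℂ`-linear functionals on `𝒟(ℝ^d)`. -/
abbrev Distrib (d : ℕ) : Type := Test d →L[ℂ] ℂ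

variable {d : ℕ}

/-- The Japanese bracket `⟨ξ⟩ = (1 + |ξ|²)^{1/2}`. -/
def bracket (ξ : Eu d) : ℝ := Real.sqrt (1 + ‖ξ‖ ^ 2)

/-- The point of `ℝ^d` given by an integer vector. -/
def latticePt (n : Fin d → ℤ) : Eu d := WithLp.toLp 2 (fun i => (n i : ℝ))

/-- The character `e_y(x) = exp(2πi y·x)`. -/
def expChar (y x : Eu d) : ℂ := Complex.exp (2 * Real.pi * Complex.I * (inner ℝ y x : ℝ))

theorem contDiff_expChar (y : Eu d) : ContDiff ℝ ∞ (expChar y) := by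
  unfold expChar
  have h : ContDiff ℝ ∞ (fun x : Eu d => ((inner ℝ y x : ℝ) : ℂ)) :=
    Complex.ofRealCLM.contDiff.comp (contDiff_const.inner ℝ contDiff_id)
  exact (contDiff_const.mul h).cexp

/-- The open cube `I_{η,x} = ∏ⱼ (xⱼ - η/2, xⱼ + η/2)`. -/
def cube (η : ℝ) (x : Eu d) : Set (Eu d) :=
  {y | ∀ j, y j ∈ Ioo (x j - η / 2) (x j + η / 2)}

/-- Open cones: open sets invariant under multiplication by positive scalars. -/
def IsOpenCone (Γ : Set (Eu d)) : Prop :=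
  IsOpen Γ ∧ ∀ ξ ∈ Γ, ∀ t : ℝ, 0 < t → t • ξ ∈ Γ

/-! ### Operations on test functions -/

/-- Multiplication `χ ↦ g χ` of test functions by a smooth function `g`. -/
def mulTest (g : Eu d → ℂ) (hg : ContDiff ℝ ∞ g) : Test d →L[ℂ] Test d :=
  TestFunction.limitCLM ℂ
    (fun χ => ⟨fun x => g x * χ x, hg.mul χ.contDiff, χ.hasCompactSupport.mul_left,
      fun _ _ => trivial⟩)
    (fun K hK => (TestFunction.ofSupportedInCLM ℂ hK).comp
      (ContDiffMapSupportedIn.bilinLeftCLM (ContinuousLinearMap.mul ℂ ℂ) hg))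
    (fun K hK χ => by
      ext x
      exact mul_comm (g x) (χ x))

theorem mulTest_apply (g : Eu d → ℂ) (hg : ContDiff ℝ ∞ g) (χ : Test d) (x : Eu d) :
    mulTest g hg χ x = g x * χ x := rfl

/-- The compact set `K + v`. -/
def shiftCompact (v : Eu d) (K : Compacts (Eu d)) : Compacts (Eu d) :=
  K.map (fun x => x + v) (by fun_prop)

/-- Translation `χ ↦ χ(· - v)` on functions supported in a fixed compact set. -/
def shiftSupportedIn (v : Eu d) (K : Compacts (Eu d)) :
    𝓓_{K}(Eu d, ℂ) →L[ℂ] 𝓓_{shiftCompact v K}(Eu d, ℂ) :=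
  ContDiffMapSupportedIn.mkCLM ℂ (fun χ x => χ (x - v))
    (fun _ _ _ => rfl) (fun _ _ _ => rfl)
    (fun χ => χ.contDiff.comp (contDiff_id.sub contDiff_const))
    (fun χ x hx => χ.zero_on_compl (fun h => hx ⟨x - v, h, by simp⟩))
    (fun i _ => ⟨{i}, 1, zero_le_one, fun χ x => by
      have h := iteratedFDeriv_comp_sub (𝕜 := ℝ) (f := (χ : Eu d → ℂ)) i v x
      intro _
      rw [h]
      simpa using ContDiffMapSupportedIn.norm_iteratedFDeriv_apply_le_seminorm_top ℂ (f := χ)⟩)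

/-- Translation `χ ↦ χ(· - v)` of test functions. -/
def shiftTest (v : Eu d) : Test d →L[ℂ] Test d :=
  TestFunction.limitCLM ℂ
    (fun χ => ⟨fun x => χ (x - v), χ.contDiff.comp (contDiff_id.sub contDiff_const),
      χ.hasCompactSupport.comp_homeomorph (Homeomorph.subRight v), fun _ _ => trivial⟩)
    (fun K _ => (TestFunction.ofSupportedInCLM ℂ (Ω := ⊤) (K := shiftCompact v K)
      (fun _ _ => trivial)).comp (shiftSupportedIn v K))
    (fun _ _ _ => rfl)

theorem shiftTest_apply (v : Eu d) (χ : Test d) (x : Eu d) : shiftTest v χ x = χ (x - v) := rfl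

/-! ### Localizations of distributions -/

/-- The product `φ f ∈ 𝒟'(ℝ^d)` of a distribution `f` and a test function `φ`:
`⟨φ f, χ⟩ = ⟨f, φ χ⟩`. -/
def localize (φ : Test d) (f : Distrib d) : Distrib d := f.comp (mulTest φ φ.contDiff)

/-- The Fourier transform of the compactly supported distribution `φ f`. It is the smooth function
`ξ ↦ ⟨φ f, e_{-ξ}⟩`, and the action of `φ f` on a smooth function `g` is `⟨φ f, g⟩ = ⟨f, g φ⟩`. -/
def fourierLocalized (φ : Test d) (f : Distrib d) (ξ : Eu d) : ℂ :=
  f (mulTest (expChar (-ξ)) (contDiff_expChar (-ξ)) φ)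

/-- For a compact set `K`, only finitely many lattice translates of `K` meet the support
of `φ`. -/
theorem finite_translates (φ : Test d) (K : Compacts (Eu d)) :
    {n : Fin d → ℤ | ∃ x ∈ (K : Set (Eu d)), x + latticePt n ∈ tsupport φ}.Finite := by
  obtain ⟨R, hR⟩ := K.isCompact.isBounded.exists_norm_le
  obtain ⟨S, hS⟩ := φ.hasCompactSupport.isCompact.isBounded.exists_norm_le
  refine (Set.finite_Icc (fun _ : Fin d => -⌈R + S⌉) (fun _ => ⌈R + S⌉)).subset ?_
  rintro n ⟨x, hx, hxn⟩
  have h1 : ‖latticePt n‖ ≤ R + S := by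
    have : latticePt n = (x + latticePt n) - x := by abel
    rw [this]
    refine (norm_sub_le _ _).trans ?_
    linarith [hR x hx, hS _ hxn]
  have h2 : ∀ i, |(n i : ℝ)| ≤ R + S := fun i => by
    simpa [latticePt] using (PiLp.norm_apply_le (latticePt n) i).trans h1
  have h3 : ∀ i, |n i| ≤ ⌈R + S⌉ := fun i => by
    have := (h2 i).trans (Int.le_ceil (R + S))
    exact_mod_cast this
  exact ⟨fun i => (abs_le.1 (h3 i)).1, fun i => (abs_le.1 (h3 i)).2⟩

theorem localize_shift_eq_zero (φ : Test d) (f : Distrib d) (K : Compacts (Eu d)) (χ : Test d)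
    (hχ : ∀ x ∉ (K : Set (Eu d)), χ x = 0) (n : Fin d → ℤ)
    (hn : n ∉ (finite_translates φ K).toFinset) :
    localize φ f (shiftTest (latticePt n) χ) = 0 := by
  have h : mulTest φ φ.contDiff (shiftTest (latticePt n) χ) = 0 := by
    ext x
    change φ x * χ (x - latticePt n) = 0
    by_cases hx : x - latticePt n ∈ (K : Set (Eu d))
    · have : x ∉ tsupport φ := fun h => hn (by
        rw [Set.Finite.mem_toFinset]
        exact ⟨_, hx, by simpa using h⟩)
      rw [image_eq_zero_of_notMem_tsupport this, zero_mul]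
    · rw [hχ _ hx, mul_zero]
  change f (mulTest φ φ.contDiff (shiftTest (latticePt n) χ)) = 0
  rw [h, map_zero]

/-- The periodic extension `(φ f)_p = ∑_{n ∈ ℤ^d} (φ f)(· + n) ∈ 𝒟'(ℝ^d)` of the compactly
supported distribution `φ f`, that is
`⟨(φ f)_p, χ⟩ = ∑_{n ∈ ℤ^d} ⟨φ f, χ(· - n)⟩`, where for each `χ` only finitely many terms of the
sum are non-zero. -/
def periodicExtension (φ : Test d) (f : Distrib d) : Distrib d :=
  TestFunction.limitCLM ℂ
    (fun χ => ∑' n : Fin d → ℤ, localize φ f (shiftTest (latticePt n) χ))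
    (fun K hK => ∑ n ∈ (finite_translates φ K).toFinset,
      ((localize φ f).comp (shiftTest (latticePt n))).comp (TestFunction.ofSupportedInCLM ℂ hK))
    (fun K hK χ => by
      rw [tsum_eq_sum (s := (finite_translates φ K).toFinset) (fun n hn =>
        localize_shift_eq_zero φ f K _ (fun x hx => χ.zero_on_compl hx) n hn)]
      simp)

theorem periodicExtension_apply (φ : Test d) (f : Distrib d) (χ : Test d) :
    periodicExtension φ f χ = ∑' n : Fin d → ℤ, localize φ f (shiftTest (latticePt n) χ) := rfl

/-- `u = ∑_{n ∈ ℤ^d} a_n e_n` in `𝒟'(ℝ^d)`: `a` is the family of the Fourier coefficients of the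
periodic distribution `u`. -/
def HasFourierSeries (u : Distrib d) (a : (Fin d → ℤ) → ℂ) : Prop :=
  ∀ χ : Test d, HasSum (fun n => a n * ∫ x, expChar (latticePt n) x * χ x) (u χ)

/-- `f` is Sobolev microlocally regular at `(x₀, ξ₀)` of order `s`: there are an open cone
`Γ ∋ ξ₀` and `ψ ∈ 𝒟(ℝ^d)`, `ψ = 1` near `x₀`, with
`∫_Γ |(ψ f)^(ξ)|² ⟨ξ⟩^{2s} dξ < ∞`. -/
def MicrolocallyRegular (s : ℝ) (f : Distrib d) (x₀ ξ₀ : Eu d) : Prop :=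
  ∃ (Γ : Set (Eu d)) (ψ : Test d), IsOpenCone Γ ∧ ξ₀ ∈ Γ ∧ (∀ᶠ x in 𝓝 x₀, ψ x = 1) ∧
    IntegrableOn (fun ξ => ‖fourierLocalized ψ f ξ‖ ^ 2 * bracket ξ ^ (2 * s)) Γ

/-- The Sobolev wave front set of order `s`, a subset of `ℝ^d × (ℝ^d ∖ {0})`. -/
def WFs (s : ℝ) (f : Distrib d) : Set (Eu d × Eu d) :=
  {p | p.2 ≠ 0 ∧ ¬ MicrolocallyRegular s f p.1 p.2}

end SobolevWF

end

/-!
The Fourier transform of a localization `φ f` is a function on `ℝ^d`, and the Fourier coefficients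
of its periodic extension are its values at the lattice points. If `ψ = 1` on the support of `φ`,
then `φ f = φ (ψ f)`, so the Fourier transform of `φ f` is the convolution of that of `ψ f` with the
rapidly decreasing function `𝓕 φ`; evaluated at lattice points, this bounds the coefficients by an
integral over `ℝ^d`. In the other direction, if `φ` is supported in a cube of side less than one and
equals one on the support of `ψ`, then `ψ f = ψ (φ f)_p`, and inserting the Fourier series of
`(φ f)_p` writes the Fourier transform of `ψ f` as a discrete convolution of the coefficients with
`𝓕 ψ`. Both implications are therefore instances of one statement,
`exists_cone_lintegral_sq_lt_top`: convolution with a rapidly decreasing kernel, from one family of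
frequencies to another, preserves weighted square integrability on cones, at the cost of narrowing
the cone. It holds for any two families of bounded density, such as `ℝ^d` with Lebesgue measure
and `ℤ^d` with counting measure, provided the function convolved has polynomial growth.

Three facts about distributions feed into it. By `exists_fourier_representation`, on test functions
supported in a fixed compact set a distribution is integration of the Fourier transform against
a function of polynomial growth in the mean. Hence the Fourier transform of `φ f` is measurable and of
polynomial growth, and distributions commute with superpositions of characters
(`apply_eq_integral_fourierLocalized`). Applied to Fourier inversion this gives the convolution
formula, and applied to the Poisson summation formula `hasSum_poisson` it gives the Fourier series of
`(φ f)_p`. Finally, coefficients of a Fourier series are unique and of polynomial growth by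
`HasFourierSeries.exists_eq_fourierLocalized`, which tests the series against a function whose
Fourier transform restricts to the unit mass at the origin of the lattice.
-/

namespace SobolevWF

open scoped ENNReal NNReal FourierTransform

/-! ### The Japanese bracket -/

section Bracket

variable {d : ℕ}

theorem one_le_bracket (ξ : Eu d) : 1 ≤ bracket ξ :=
  Real.one_le_sqrt.2 (by nlinarith [sq_nonneg ‖ξ‖])

theorem bracket_pos (ξ : Eu d) : 0 < bracket ξ := one_pos.trans_le (one_le_bracket ξ)

theorem norm_le_bracket (ξ : Eu d) : ‖ξ‖ ≤ bracket ξ :=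
  Real.le_sqrt_of_sq_le (by linarith)

theorem bracket_le_one_add_norm (ξ : Eu d) : bracket ξ ≤ 1 + ‖ξ‖ :=
  sqrt_one_add_norm_sq_le ξ

theorem bracket_neg (ξ : Eu d) : bracket (-ξ) = bracket ξ := by simp [bracket]

theorem continuous_bracket : Continuous (bracket : Eu d → ℝ) := by
  unfold bracket; fun_prop

theorem continuous_bracket_rpow (t : ℝ) : Continuous (fun ξ : Eu d => bracket ξ ^ t) :=
  continuous_bracket.rpow_const fun ξ => Or.inl (bracket_pos ξ).ne'

theorem bracket_add_le (x y : Eu d) : bracket (x + y) ≤ 2 * bracket x * bracket y := by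
  refine Real.sqrt_le_iff.2 ⟨by positivity [bracket_pos x, bracket_pos y], ?_⟩
  have hx : bracket x ^ 2 = 1 + ‖x‖ ^ 2 := Real.sq_sqrt (by positivity)
  have hy : bracket y ^ 2 = 1 + ‖y‖ ^ 2 := Real.sq_sqrt (by positivity)
  have h := norm_add_le x y
  have h2 : ‖x + y‖ ^ 2 ≤ (‖x‖ + ‖y‖) ^ 2 := by gcongr
  calc 1 + ‖x + y‖ ^ 2 ≤ 4 * (1 + ‖x‖ ^ 2) * (1 + ‖y‖ ^ 2) := by
        nlinarith [sq_nonneg (‖x‖ - ‖y‖), sq_nonneg ‖x‖, sq_nonneg ‖y‖,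
          mul_nonneg (sq_nonneg ‖x‖) (sq_nonneg ‖y‖)]
    _ = (2 * bracket x * bracket y) ^ 2 := by rw [← hx, ← hy]; ring

/-- Peetre's inequality. -/
theorem bracket_rpow_le (t : ℝ) (x y : Eu d) :
    bracket x ^ t ≤ 2 ^ |t| * bracket y ^ t * bracket (x - y) ^ |t| := by
  have hx := bracket_pos x
  have hy := bracket_pos y
  have hxy := bracket_pos (x - y)
  rcases le_total 0 t with ht | ht
  · rw [abs_of_nonneg ht, ← Real.mul_rpow (by norm_num) hy.le, ← Real.mul_rpow (by positivity) hxy.le]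
    refine Real.rpow_le_rpow hx.le ?_ ht
    simpa using bracket_add_le y (x - y)
  · have h : bracket y ≤ 2 * bracket x * bracket (x - y) := by
      have := bracket_add_le x (y - x)
      rwa [add_sub_cancel, ← neg_sub x y, bracket_neg] at this
    have h2 := Real.rpow_le_rpow hy.le h (neg_nonneg.2 ht)
    rw [abs_of_nonpos ht]
    rw [Real.mul_rpow (by positivity) hxy.le, Real.mul_rpow (by norm_num) hx.le] at h2
    have e1 : bracket x ^ t * bracket x ^ (-t) = 1 := by
      rw [← Real.rpow_add hx]; simp
    have e2 : bracket y ^ t * bracket y ^ (-t) = 1 := by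
      rw [← Real.rpow_add hy]; simp
    calc bracket x ^ t = bracket x ^ t * bracket y ^ t * bracket y ^ (-t) := by
          rw [mul_assoc, e2, mul_one]
      _ ≤ bracket x ^ t * bracket y ^ t *
          (2 ^ (-t) * bracket x ^ (-t) * bracket (x - y) ^ (-t)) := by gcongr
      _ = (bracket x ^ t * bracket x ^ (-t)) *
          (2 ^ (-t) * bracket y ^ t * bracket (x - y) ^ (-t)) := by ring
      _ = _ := by rw [e1, one_mul]

theorem integrable_bracket_rpow : Integrable (fun ξ : Eu d => bracket ξ ^ (-((d : ℝ) + 1))) := by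
  have h := integrable_rpow_neg_one_add_norm_sq (E := Eu d) (μ := volume) (r := (d : ℝ) + 1)
    (by simp)
  refine h.congr (Eventually.of_forall fun ξ => ?_)
  simp only [bracket, Real.sqrt_eq_rpow]
  rw [← Real.rpow_mul (by positivity)]
  congr 1; ring

/-- The weight `⟨ξ⟩ ^ t` as an extended nonnegative real. -/
noncomputable def weight (t : ℝ) (ξ : Eu d) : ℝ≥0∞ := ENNReal.ofReal (bracket ξ ^ t)

theorem weight_add (s t : ℝ) (ξ : Eu d) : weight (s + t) ξ = weight s ξ * weight t ξ := by
  rw [weight, Real.rpow_add (bracket_pos ξ),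
    ENNReal.ofReal_mul (Real.rpow_nonneg (bracket_pos ξ).le _)]
  rfl

theorem weight_neg_arg (t : ℝ) (ξ : Eu d) : weight t (-ξ) = weight t ξ := by
  simp [weight, bracket_neg]

theorem weight_sub_comm (t : ℝ) (ξ η : Eu d) : weight t (ξ - η) = weight t (η - ξ) := by
  rw [← neg_sub, weight_neg_arg]

theorem weight_ne_top (t : ℝ) (ξ : Eu d) : weight t ξ ≠ ⊤ := ENNReal.ofReal_ne_top

theorem weight_mono {s t : ℝ} (h : s ≤ t) (ξ : Eu d) : weight s ξ ≤ weight t ξ :=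
  ENNReal.ofReal_le_ofReal (Real.rpow_le_rpow_of_exponent_le (one_le_bracket ξ) h)

theorem measurable_weight (t : ℝ) : Measurable (weight t : Eu d → ℝ≥0∞) :=
  (continuous_bracket_rpow t).measurable.ennreal_ofReal

theorem weight_le (t : ℝ) (x y : Eu d) :
    weight t x ≤ ENNReal.ofReal (2 ^ |t|) * weight t y * weight |t| (x - y) := by
  have := bracket_pos x
  have := bracket_pos y
  rw [weight, weight, weight, ← ENNReal.ofReal_mul (by positivity),
    ← ENNReal.ofReal_mul (by positivity)]
  exact ENNReal.ofReal_le_ofReal (bracket_rpow_le t x y)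

/-- If `⟨x⟩ ≤ c ⟨y⟩`, then `⟨x⟩ ^ t ≤ c ^ t ⟨y⟩ ^ t` for `t ≥ 0`. -/
theorem weight_le_of_bracket_le {c t : ℝ} (hc : 0 ≤ c) (ht : 0 ≤ t) {x y : Eu d}
    (h : bracket x ≤ c * bracket y) : weight t x ≤ ENNReal.ofReal (c ^ t) * weight t y := by
  have := bracket_pos y
  rw [weight, weight, ← ENNReal.ofReal_mul (by positivity), ← Real.mul_rpow hc (by positivity)]
  exact ENNReal.ofReal_le_ofReal (Real.rpow_le_rpow (bracket_pos x).le h ht)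

theorem weight_neg_le_of_bracket_le {c t : ℝ} (hc : 0 ≤ c) (ht : 0 ≤ t) {x y : Eu d}
    (h : bracket x ≤ c * bracket y) : weight (-t) y ≤ ENNReal.ofReal (c ^ t) * weight (-t) x := by
  have hone : ∀ z : Eu d, weight (-t) z * weight t z = 1 := fun z => by
    rw [← weight_add]; simp [weight]
  calc weight (-t) y = weight (-t) y * (weight (-t) x * weight t x) := by rw [hone, mul_one]
    _ ≤ weight (-t) y * (weight (-t) x * (ENNReal.ofReal (c ^ t) * weight t y)) := by
        gcongr; exact weight_le_of_bracket_le hc ht h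
    _ = (weight (-t) y * weight t y) * (ENNReal.ofReal (c ^ t) * weight (-t) x) := by ring
    _ = _ := by rw [hone, one_mul]

end Bracket

/-! ### The unit cells of the integer lattice -/

section Cells

variable {d : ℕ}

/-- The half-open unit cell `n + (0, 1]^d`. -/
def cell (n : Fin d → ℤ) : Set (Eu d) := {x | ∀ i, x i ∈ Ioc (n i : ℝ) (n i + 1)}

theorem measurableSet_cell (n : Fin d → ℤ) : MeasurableSet (cell n) := by
  have : cell n = ⋂ i, (fun x : Eu d => x i) ⁻¹' Ioc (n i : ℝ) (n i + 1) := by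
    ext x; simp [cell]
  rw [this]
  exact MeasurableSet.iInter fun i => (by fun_prop : Measurable fun x : Eu d => x i) measurableSet_Ioc

theorem iUnion_cell : ⋃ n, cell (d := d) n = univ := by
  refine eq_univ_of_forall fun x => mem_iUnion.2 ⟨fun i => ⌈x i⌉ - 1, fun i => ?_⟩
  have h1 := Int.le_ceil (x i)
  have h2 := Int.ceil_lt_add_one (x i)
  constructor <;> push_cast <;> linarith

theorem pairwise_disjoint_cell : Pairwise (Function.onFun Disjoint (cell (d := d))) := by
  intro m n hmn
  refine Set.disjoint_left.2 fun x hm hn => hmn (funext fun i => ?_)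
  have h1 := hm i
  have h2 := hn i
  have a : (m i : ℝ) < n i + 1 := h1.1.trans_le h2.2
  have b : (n i : ℝ) < m i + 1 := h2.1.trans_le h1.2
  have a' : m i < n i + 1 := by exact_mod_cast a
  have b' : n i < m i + 1 := by exact_mod_cast b
  omega

theorem volume_cell (n : Fin d → ℤ) : volume (cell n) = 1 := by
  have : cell n = (MeasurableEquiv.toLp 2 (Fin d → ℝ)).symm ⁻¹'
      (Set.pi univ fun i => Ioc (n i : ℝ) (n i + 1)) := by
    ext x; simp [cell]
  rw [this, (EuclideanSpace.volume_preserving_symm_measurableEquiv_toLp (Fin d)).measure_preimage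
    (MeasurableSet.univ_pi fun i => measurableSet_Ioc).nullMeasurableSet, Real.volume_pi_Ioc]
  simp

theorem norm_sub_latticePt_le {n : Fin d → ℤ} {x : Eu d} (hx : x ∈ cell n) :
    ‖x - latticePt n‖ ≤ d + 1 := by
  have h : ‖x - latticePt n‖ ^ 2 ≤ d := by
    rw [EuclideanSpace.norm_sq_eq]
    calc ∑ i, ‖(x - latticePt n) i‖ ^ 2 ≤ ∑ _i : Fin d, (1 : ℝ) := by
          refine Finset.sum_le_sum fun i _ => ?_
          have := hx i
          have e : (x - latticePt n) i = x i - n i := rfl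
          rw [e, Real.norm_eq_abs, sq_abs]
          nlinarith [this.1, this.2]
      _ = d := by simp
  nlinarith [norm_nonneg (x - latticePt n), (Nat.cast_nonneg d : (0 : ℝ) ≤ d)]

end Cells

/-! ### Families of frequencies of bounded density -/

section BoundedDensity

variable {d : ℕ} {α : Type*} [MeasurableSpace α]

/-- A family of frequencies `y`, indexed by a measure space, has bounded density if
`∫ ⟨η - y a⟩ ^ (-(d + 1)) dμ(a)` is bounded uniformly in `η`. The two examples are `ℝ^d` itself,
with Lebesgue measure, and the integer lattice, with counting measure. -/
structure BoundedDensity (μ : Measure α) (y : α → Eu d) : Prop where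
  measurable : Measurable y
  bound : ∃ A : ℝ≥0∞, A ≠ ⊤ ∧ ∀ η, ∫⁻ a, weight (-((d : ℝ) + 1)) (η - y a) ∂μ ≤ A

theorem lintegral_weight_ne_top : ∫⁻ ξ : Eu d, weight (-((d : ℝ) + 1)) ξ ≠ ⊤ := by
  have h := integrable_bracket_rpow (d := d)
  have := h.lintegral_lt_top.ne
  exact this

theorem boundedDensity_volume : BoundedDensity (d := d) volume id where
  measurable := measurable_id
  bound := ⟨_, lintegral_weight_ne_top, fun η => by
    simp only [id]
    exact (lintegral_sub_left_eq_self (weight (-((d : ℝ) + 1))) η).le⟩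

theorem boundedDensity_lattice :
    BoundedDensity (Measure.count : Measure (Fin d → ℤ)) (latticePt (d := d)) where
  measurable := measurable_of_countable _
  bound := by
    set M : ℝ := (d : ℝ) + 1
    have hM : 0 ≤ M := by positivity
    -- each lattice value is comparable with the average over the adjacent unit cell
    set c : ℝ≥0∞ := ENNReal.ofReal (2 ^ |(-M)|) * ENNReal.ofReal ((d + 2) ^ |(-M)|)
    refine ⟨c * ∫⁻ ξ : Eu d, weight (-M) ξ,
      ENNReal.mul_ne_top (ENNReal.mul_ne_top ENNReal.ofReal_ne_top ENNReal.ofReal_ne_top)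
        lintegral_weight_ne_top, fun η => ?_⟩
    have key : ∀ n : Fin d → ℤ, weight (-M) (η - latticePt n) ≤
        ∫⁻ x in cell n, c * weight (-M) (η - x) := fun n => by
      calc weight (-M) (η - latticePt n) = ∫⁻ _x in cell n, weight (-M) (η - latticePt n) := by
            simp [volume_cell]
        _ ≤ _ := by
            refine setLIntegral_mono ((measurable_weight _).comp (by fun_prop) |>.const_mul _)
              fun x hx => ?_
            refine (weight_le (-M) (η - latticePt n) (η - x)).trans ?_
            have hb : weight |(-M)| (η - latticePt n - (η - x)) ≤
                ENNReal.ofReal ((d + 2) ^ |(-M)|) := by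
              rw [show η - latticePt n - (η - x) = x - latticePt n by abel]
              refine ENNReal.ofReal_le_ofReal (Real.rpow_le_rpow (bracket_pos _).le ?_ (abs_nonneg _))
              have := norm_sub_latticePt_le hx
              have := bracket_le_one_add_norm (x - latticePt n)
              linarith
            calc _ ≤ ENNReal.ofReal (2 ^ |(-M)|) * weight (-M) (η - x) *
                  ENNReal.ofReal ((d + 2) ^ |(-M)|) := by gcongr
              _ = _ := by simp only [c]; ring
    rw [lintegral_count]
    calc ∑' n, weight (-M) (η - latticePt n) ≤ ∑' n, ∫⁻ x in cell n, c * weight (-M) (η - x) :=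
          ENNReal.tsum_le_tsum key
      _ = ∫⁻ x, c * weight (-M) (η - x) := by
          rw [← lintegral_iUnion measurableSet_cell pairwise_disjoint_cell, iUnion_cell,
            setLIntegral_univ]
      _ = c * ∫⁻ ξ : Eu d, weight (-M) ξ := by
          have hm : Measurable fun x : Eu d => weight (-M) (η - x) :=
            (measurable_weight _).comp (by fun_prop)
          rw [lintegral_const_mul _ hm, lintegral_sub_left_eq_self (weight (-M)) η]

end BoundedDensity

/-! ### Convolution-type estimates on cones -/

section Cones

variable {d : ℕ}

/-- Every open cone around `ξ₀` contains a narrower one that is separated from the complement of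
the first: the distance of `η` in the narrow cone to any `ξ` outside the wide one is at least
a fixed multiple of `‖η‖`. -/
theorem IsOpenCone.exists_narrower {Γ : Set (Eu d)} (hΓ : IsOpenCone Γ) {ξ₀ : Eu d}
    (hξ₀ : ξ₀ ∈ Γ) :
    ∃ Γ' : Set (Eu d), IsOpenCone Γ' ∧ ξ₀ ∈ Γ' ∧ ∃ c : ℝ, 0 < c ∧
      ∀ η ∈ Γ', ∀ ξ ∉ Γ, ‖η‖ ≤ c * ‖η - ξ‖ := by
  obtain ⟨r, hr, hball⟩ := Metric.isOpen_iff.1 hΓ.1 ξ₀ hξ₀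
  refine ⟨⋃ t : {t : ℝ // 0 < t}, (fun x => (t : ℝ)⁻¹ • x) ⁻¹' Metric.ball ξ₀ (r / 2),
    ⟨isOpen_iUnion fun t => Metric.isOpen_ball.preimage (by fun_prop), ?_⟩, ?_,
    2 * (‖ξ₀‖ + r) / r, by positivity, ?_⟩
  · intro ξ hξ t ht
    obtain ⟨u, hu⟩ := mem_iUnion.1 hξ
    refine mem_iUnion.2 ⟨⟨t * u, mul_pos ht u.2⟩, ?_⟩
    have : ((t * (u : ℝ))⁻¹) • (t • ξ) = (u : ℝ)⁻¹ • ξ := by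
      rw [smul_smul]; congr 1; field_simp
    simpa only [mem_preimage, this] using hu
  · exact mem_iUnion.2 ⟨⟨1, one_pos⟩, by simpa using half_pos hr⟩
  · intro η hη ξ hξ
    obtain ⟨⟨t, ht⟩, hu⟩ := mem_iUnion.1 hη
    simp only [mem_preimage, Metric.mem_ball, dist_eq_norm] at hu
    have h1 : r ≤ ‖t⁻¹ • ξ - ξ₀‖ := by
      by_contra! hlt
      refine hξ ?_
      have := hΓ.2 _ (hball (by simpa [dist_eq_norm] using hlt)) t ht
      rwa [smul_smul, mul_inv_cancel₀ ht.ne', one_smul] at this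
    have h2 : r / 2 ≤ t⁻¹ * ‖η - ξ‖ := by
      have e : t⁻¹ * ‖η - ξ‖ = ‖t⁻¹ • η - t⁻¹ • ξ‖ := by
        rw [← smul_sub, norm_smul, Real.norm_of_nonneg (inv_pos.2 ht).le]
      have := norm_sub_le_norm_sub_add_norm_sub (t⁻¹ • ξ) (t⁻¹ • η) ξ₀
      rw [e, norm_sub_rev]; linarith
    have h3 : t⁻¹ * ‖η‖ ≤ ‖ξ₀‖ + r := by
      have e : t⁻¹ * ‖η‖ = ‖t⁻¹ • η‖ := by
        rw [norm_smul, Real.norm_of_nonneg (inv_pos.2 ht).le]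
      have := norm_le_norm_add_norm_sub' (t⁻¹ • η) ξ₀
      rw [e]; linarith
    have h4 : ‖η‖ ≤ t * (‖ξ₀‖ + r) := by
      rwa [inv_mul_le_iff₀ ht] at h3
    have h5 : t * (r / 2) ≤ ‖η - ξ‖ := by
      rwa [le_inv_mul_iff₀ ht] at h2
    calc ‖η‖ ≤ t * (‖ξ₀‖ + r) := h4
      _ = 2 * (‖ξ₀‖ + r) / r * (t * (r / 2)) := by field_simp
      _ ≤ _ := by gcongr

/-- Cauchy–Schwarz with respect to the measure `w ^ 2 dμ`. -/
theorem sq_lintegral_sq_mul_le {α : Type*} [MeasurableSpace α] (μ : Measure α) {w F : α → ℝ≥0∞}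
    (hw : AEMeasurable w μ) (hF : AEMeasurable F μ) :
    (∫⁻ a, w a * w a * F a ∂μ) ^ 2 ≤
      (∫⁻ a, w a * w a ∂μ) * ∫⁻ a, w a * w a * F a ^ 2 ∂μ := by
  have h := ENNReal.lintegral_mul_le_Lp_mul_Lq μ Real.HolderConjugate.two_two hw (hw.mul hF)
  have e1 : (fun a => w a * w a * F a) = w * (w * F) := by ext a; simp [mul_assoc]
  rw [e1]
  refine (pow_le_pow_left₀ zero_le h 2).trans (le_of_eq ?_)
  rw [mul_pow, ← ENNReal.rpow_natCast, ← ENNReal.rpow_natCast, ← ENNReal.rpow_mul,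
    ← ENNReal.rpow_mul]
  norm_num
  simp only [pow_two]
  congr 1
  exact lintegral_congr fun a => by ring

theorem add_sq_le_four_mul (a b : ℝ≥0∞) : (a + b) ^ 2 ≤ 4 * (a ^ 2 + b ^ 2) := by
  have h : a + b ≤ 2 * max a b := by
    rw [two_mul]; exact add_le_add (le_max_left _ _) (le_max_right _ _)
  calc (a + b) ^ 2 ≤ (2 * max a b) ^ 2 := pow_le_pow_left₀ zero_le h 2
    _ = 4 * max a b ^ 2 := by rw [mul_pow]; norm_num
    _ ≤ _ := by
      gcongr
      rcases le_total a b with h | h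
      · rw [max_eq_right h]; exact le_add_self
      · rw [max_eq_left h]; exact le_self_add

variable {α β : Type*} [MeasurableSpace α] [MeasurableSpace β] {μ : Measure α} {ν : Measure β}
  {y : α → Eu d} {z : β → Eu d}

/-- Convolution with a rapidly decreasing kernel is bounded on weighted `L²`. -/
theorem lintegral_sq_convolution_lt_top [SFinite μ] [SFinite ν] (hμ : BoundedDensity μ y)
    (hν : BoundedDensity ν z) {k : Eu d → ℝ≥0∞}
    (hk : ∀ M : ℝ, ∃ C : ℝ≥0∞, C ≠ ⊤ ∧ ∀ ξ, k ξ ≤ C * weight (-M) ξ)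
    {F : α → ℝ≥0∞} (hF : Measurable F) (s : ℝ)
    (hreg : ∫⁻ a, F a ^ 2 * weight (2 * s) (y a) ∂μ < ⊤) :
    ∫⁻ b, (∫⁻ a, k (z b - y a) * F a ∂μ) ^ 2 * weight (2 * s) (z b) ∂ν < ⊤ := by
  have hym := hμ.measurable
  have hzm := hν.measurable
  obtain ⟨A, hA, hAb⟩ := hμ.bound
  obtain ⟨B, hB, hBb⟩ := hν.bound
  set m : ℝ := (d : ℝ) + 1
  -- half the decay of the kernel is `p`, so that `⟨·⟩ ^ (-2p)` absorbs Peetre's factor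
  set p : ℝ := (|2 * s| + m) / 2 with hp
  obtain ⟨C, hC, hkC⟩ := hk (2 * p)
  set c : ℝ≥0∞ := ENNReal.ofReal (2 ^ |2 * s|)
  have hW : ∀ b, Measurable fun a => weight (-p) (z b - y a) := fun b =>
    (measurable_weight _).comp (measurable_const.sub hym)
  have hWW : ∀ b, Measurable fun a => weight (-p) (z b - y a) * weight (-p) (z b - y a) :=
    fun b => (hW b).mul (hW b)
  have hFw : Measurable fun a => F a ^ 2 * weight (2 * s) (y a) :=
    (hF.pow_const 2).mul ((measurable_weight _).comp hym)
  have hpt : ∀ b, (∫⁻ a, k (z b - y a) * F a ∂μ) ^ 2 * weight (2 * s) (z b) ≤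
      C ^ 2 * A * c * ∫⁻ a, weight (-m) (z b - y a) * (F a ^ 2 * weight (2 * s) (y a)) ∂μ := by
    intro b
    have h1 : ∫⁻ a, k (z b - y a) * F a ∂μ ≤
        C * ∫⁻ a, weight (-p) (z b - y a) * weight (-p) (z b - y a) * F a ∂μ := by
      have hm : Measurable fun a => weight (-p) (z b - y a) * weight (-p) (z b - y a) * F a :=
        (hWW b).mul hF
      rw [← lintegral_const_mul _ hm]
      refine lintegral_mono fun a => ?_
      rw [← weight_add, ← mul_assoc, show -p + -p = -(2 * p) by ring]
      gcongr
      exact hkC _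
    have h2 : ∫⁻ a, weight (-p) (z b - y a) * weight (-p) (z b - y a) ∂μ ≤ A := by
      refine (lintegral_mono fun a => ?_).trans (hAb (z b))
      rw [← weight_add]
      exact weight_mono (by rw [hp]; linarith [abs_nonneg (2 * s)]) _
    have h3 := sq_lintegral_sq_mul_le μ (hW b).aemeasurable hF.aemeasurable
    have h4 : (∫⁻ a, weight (-p) (z b - y a) * weight (-p) (z b - y a) * F a ^ 2 ∂μ) *
        weight (2 * s) (z b) ≤
        c * ∫⁻ a, weight (-m) (z b - y a) * (F a ^ 2 * weight (2 * s) (y a)) ∂μ := by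
      have hm : Measurable fun a =>
          weight (-p) (z b - y a) * weight (-p) (z b - y a) * F a ^ 2 :=
        (hWW b).mul (hF.pow_const 2)
      have hm' : Measurable fun a =>
          weight (-m) (z b - y a) * (F a ^ 2 * weight (2 * s) (y a)) :=
        ((measurable_weight _).comp (measurable_const.sub hym)).mul hFw
      rw [← lintegral_mul_const _ hm, ← lintegral_const_mul _ hm']
      refine lintegral_mono fun a => ?_
      calc weight (-p) (z b - y a) * weight (-p) (z b - y a) * F a ^ 2 * weight (2 * s) (z b)
          ≤ weight (-p) (z b - y a) * weight (-p) (z b - y a) * F a ^ 2 *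
            (c * weight (2 * s) (y a) * weight |2 * s| (z b - y a)) := by
            gcongr; exact weight_le _ _ _
        _ = c * ((weight (-p) (z b - y a) * weight (-p) (z b - y a) * weight |2 * s| (z b - y a)) *
            (F a ^ 2 * weight (2 * s) (y a))) := by ring
        _ = _ := by
            rw [← weight_add, ← weight_add, show -p + -p + |2 * s| = -m by rw [hp]; ring]
    calc _ ≤ (C * ∫⁻ a, weight (-p) (z b - y a) * weight (-p) (z b - y a) * F a ∂μ) ^ 2 *
          weight (2 * s) (z b) := by gcongr
      _ ≤ C ^ 2 * (A * ∫⁻ a, weight (-p) (z b - y a) * weight (-p) (z b - y a) * F a ^ 2 ∂μ) *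
          weight (2 * s) (z b) := by
          rw [mul_pow]; gcongr; exact h3.trans (by gcongr)
      _ = C ^ 2 * A * ((∫⁻ a, weight (-p) (z b - y a) * weight (-p) (z b - y a) * F a ^ 2 ∂μ) *
          weight (2 * s) (z b)) := by ring
      _ ≤ C ^ 2 * A * (c * ∫⁻ a, weight (-m) (z b - y a) *
          (F a ^ 2 * weight (2 * s) (y a)) ∂μ) := by gcongr
      _ = _ := by ring
  have hmeas : Measurable (Function.uncurry fun (b : β) (a : α) =>
      weight (-m) (z b - y a) * (F a ^ 2 * weight (2 * s) (y a))) := by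
    refine ((measurable_weight _).comp ((hzm.comp measurable_fst).sub
      (hym.comp measurable_snd))).mul ?_
    exact hFw.comp measurable_snd
  have hin : ∀ a, ∫⁻ b, weight (-m) (z b - y a) * (F a ^ 2 * weight (2 * s) (y a)) ∂ν ≤
      B * (F a ^ 2 * weight (2 * s) (y a)) := fun a => by
    have hm : Measurable fun b => weight (-m) (z b - y a) :=
      (measurable_weight _).comp (hzm.sub measurable_const)
    rw [lintegral_mul_const _ hm]
    gcongr
    simpa only [weight_sub_comm] using hBb (y a)
  calc _ ≤ ∫⁻ b, C ^ 2 * A * c * ∫⁻ a, weight (-m) (z b - y a) *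
        (F a ^ 2 * weight (2 * s) (y a)) ∂μ ∂ν := lintegral_mono hpt
    _ = C ^ 2 * A * c * ∫⁻ b, ∫⁻ a, weight (-m) (z b - y a) *
        (F a ^ 2 * weight (2 * s) (y a)) ∂μ ∂ν :=
        lintegral_const_mul _ hmeas.lintegral_prod_right'
    _ = C ^ 2 * A * c * ∫⁻ a, ∫⁻ b, weight (-m) (z b - y a) *
        (F a ^ 2 * weight (2 * s) (y a)) ∂ν ∂μ := by
        rw [lintegral_lintegral_swap hmeas.aemeasurable]
    _ ≤ C ^ 2 * A * c * ∫⁻ a, B * (F a ^ 2 * weight (2 * s) (y a)) ∂μ := by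
        gcongr; exact hin _
    _ = C ^ 2 * A * c * (B * ∫⁻ a, F a ^ 2 * weight (2 * s) (y a) ∂μ) := by
        rw [lintegral_const_mul _ hFw]
    _ < ⊤ := by
        refine ENNReal.mul_lt_top ?_ (ENNReal.mul_lt_top hB.lt_top hreg)
        exact (ENNReal.mul_ne_top (ENNReal.mul_ne_top (ENNReal.pow_ne_top hC) hA)
          ENNReal.ofReal_ne_top).lt_top

/-- Frequencies outside the wide cone contribute a rapidly decreasing amount to the convolution on
the narrow cone. -/
theorem lintegral_sq_convolution_far_lt_top (hμ : BoundedDensity μ y)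
    (hν : BoundedDensity ν z) {k : Eu d → ℝ≥0∞}
    (hk : ∀ M : ℝ, ∃ C : ℝ≥0∞, C ≠ ⊤ ∧ ∀ ξ, k ξ ≤ C * weight (-M) ξ)
    {F : α → ℝ≥0∞} {N : ℝ} (hN : 0 ≤ N) {D : ℝ≥0∞} (hD : D ≠ ⊤)
    (hFN : ∀ a, F a ≤ D * weight N (y a)) {Γ Γ' : Set (Eu d)} (hΓ' : MeasurableSet Γ')
    {c : ℝ} (hc : 0 < c) (hsep : ∀ η ∈ Γ', ∀ ξ ∉ Γ, ‖η‖ ≤ c * ‖η - ξ‖) (s : ℝ) :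
    ∫⁻ b in z ⁻¹' Γ', (∫⁻ a in (y ⁻¹' Γ)ᶜ, k (z b - y a) * F a ∂μ) ^ 2 *
      weight (2 * s) (z b) ∂ν < ⊤ := by
  have hym := hμ.measurable
  have hzm := hν.measurable
  obtain ⟨A, hA, hAb⟩ := hμ.bound
  obtain ⟨B, hB, hBb⟩ := hν.bound
  set m : ℝ := (d : ℝ) + 1
  have hm : 0 < m := by positivity
  -- decay in `⟨η⟩` that makes the square integrable against `⟨η⟩ ^ (2 s)`
  set L : ℝ := (|2 * s| + m) / 2 with hL
  have hL0 : 0 ≤ L := by positivity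
  obtain ⟨C, hC, hkC⟩ := hk (m + N + L)
  set c₁ : ℝ≥0∞ := ENNReal.ofReal ((2 + c) ^ N)
  set c₂ : ℝ≥0∞ := ENNReal.ofReal ((2 + c) ^ L)
  set E : ℝ≥0∞ := C * D * c₁ * c₂ with hE
  have hbr : ∀ η ∈ Γ', ∀ ξ ∉ Γ, bracket η ≤ (2 + c) * bracket (η - ξ) ∧
      bracket ξ ≤ (2 + c) * bracket (η - ξ) := fun η hη ξ hξ => by
    have h1 := hsep η hη ξ hξ
    have h2 := norm_le_bracket (η - ξ)
    have h3 := bracket_le_one_add_norm η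
    have h4 := bracket_le_one_add_norm ξ
    have h5 := one_le_bracket (η - ξ)
    have h6 : ‖ξ‖ ≤ ‖η‖ + ‖η - ξ‖ := by
      have := norm_sub_le η (η - ξ)
      rwa [sub_sub_cancel] at this
    have h7 : c * ‖η - ξ‖ ≤ c * bracket (η - ξ) := by gcongr
    constructor <;> nlinarith
  have hpt : ∀ b ∈ z ⁻¹' Γ', (∫⁻ a in (y ⁻¹' Γ)ᶜ, k (z b - y a) * F a ∂μ) ^ 2 *
      weight (2 * s) (z b) ≤ (E * A) ^ 2 * weight (-m) (0 - z b) := by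
    intro b hb
    have h1 : ∀ a ∈ (y ⁻¹' Γ)ᶜ, k (z b - y a) * F a ≤
        E * weight (-L) (z b) * weight (-m) (z b - y a) := fun a ha => by
      obtain ⟨g1, g2⟩ := hbr _ hb _ ha
      calc k (z b - y a) * F a
          ≤ C * weight (-(m + N + L)) (z b - y a) * (D * (c₁ * weight N (z b - y a))) := by
            gcongr
            · exact hkC _
            · exact (hFN a).trans (by
                gcongr; exact weight_le_of_bracket_le (by positivity) hN g2)
        _ = C * D * c₁ * (weight (-(m + N + L)) (z b - y a) * weight N (z b - y a)) := by ring
        _ = C * D * c₁ * (weight (-m) (z b - y a) * weight (-L) (z b - y a)) := by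
            rw [← weight_add, ← weight_add]; congr 2; ring
        _ ≤ C * D * c₁ * (weight (-m) (z b - y a) * (c₂ * weight (-L) (z b))) := by
            gcongr; exact weight_neg_le_of_bracket_le (by positivity) hL0 g1
        _ = _ := by rw [hE]; ring
    have hmk : Measurable fun a => weight (-m) (z b - y a) :=
      (measurable_weight _).comp (measurable_const.sub hym)
    have h2 : ∫⁻ a in (y ⁻¹' Γ)ᶜ, k (z b - y a) * F a ∂μ ≤ E * weight (-L) (z b) * A := by
      calc _ ≤ ∫⁻ a in (y ⁻¹' Γ)ᶜ, E * weight (-L) (z b) * weight (-m) (z b - y a) ∂μ :=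
            setLIntegral_mono (hmk.const_mul _) h1
        _ ≤ ∫⁻ a, E * weight (-L) (z b) * weight (-m) (z b - y a) ∂μ :=
            setLIntegral_le_lintegral _ _
        _ = E * weight (-L) (z b) * ∫⁻ a, weight (-m) (z b - y a) ∂μ :=
            lintegral_const_mul _ hmk
        _ ≤ _ := by gcongr; exact hAb _
    calc _ ≤ (E * weight (-L) (z b) * A) ^ 2 * weight (2 * s) (z b) := by gcongr
      _ = (E * A) ^ 2 * (weight (-L) (z b) * weight (-L) (z b) * weight (2 * s) (z b)) := by ring
      _ = (E * A) ^ 2 * weight (-L + -L + 2 * s) (z b) := by rw [← weight_add, ← weight_add]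
      _ ≤ (E * A) ^ 2 * weight (-m) (z b) := by
          gcongr
          exact weight_mono (by rw [hL]; linarith [le_abs_self (2 * s)]) _
      _ = _ := by rw [zero_sub, weight_neg_arg]
  calc _ ≤ ∫⁻ b in z ⁻¹' Γ', (E * A) ^ 2 * weight (-m) (0 - z b) ∂ν :=
        setLIntegral_mono' (hzm hΓ') hpt
    _ ≤ ∫⁻ b, (E * A) ^ 2 * weight (-m) (0 - z b) ∂ν := setLIntegral_le_lintegral _ _
    _ = (E * A) ^ 2 * ∫⁻ b, weight (-m) (0 - z b) ∂ν :=
        lintegral_const_mul _ ((measurable_weight _).comp (measurable_const.sub hzm))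
    _ ≤ (E * A) ^ 2 * B := by gcongr; exact hBb 0
    _ < ⊤ := by
        refine ENNReal.mul_lt_top (ENNReal.pow_lt_top (ENNReal.mul_lt_top ?_ hA.lt_top)) hB.lt_top
        exact (ENNReal.mul_ne_top (ENNReal.mul_ne_top (ENNReal.mul_ne_top hC hD)
          ENNReal.ofReal_ne_top) ENNReal.ofReal_ne_top).lt_top

/-- Microlocal stability of weighted square integrability. If `G` is dominated by the convolution
of `F`, of polynomial growth, with a rapidly decreasing kernel, and `F` is square integrable on an
open cone with respect to the weight `⟨·⟩ ^ (2 s)`, then so is `G` on a narrower cone. Frequencies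
of `F` inside the wide cone are handled by boundedness of the convolution on weighted `L²`, those
outside by the separation of the cones. -/
theorem exists_cone_lintegral_sq_lt_top [SFinite μ] [SFinite ν] (hμ : BoundedDensity μ y)
    (hν : BoundedDensity ν z) {k : Eu d → ℝ≥0∞} (hkm : Measurable k)
    (hk : ∀ M : ℝ, ∃ C : ℝ≥0∞, C ≠ ⊤ ∧ ∀ ξ, k ξ ≤ C * weight (-M) ξ)
    {F : α → ℝ≥0∞} (hF : Measurable F) {N : ℝ} (hN : 0 ≤ N) {D : ℝ≥0∞} (hD : D ≠ ⊤)
    (hFN : ∀ a, F a ≤ D * weight N (y a)) {G : β → ℝ≥0∞}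
    (hG : ∀ b, G b ≤ ∫⁻ a, k (z b - y a) * F a ∂μ) {Γ : Set (Eu d)} (hΓ : IsOpenCone Γ)
    {ξ₀ : Eu d} (hξ₀ : ξ₀ ∈ Γ) (s : ℝ)
    (hreg : ∫⁻ a in y ⁻¹' Γ, F a ^ 2 * weight (2 * s) (y a) ∂μ < ⊤) :
    ∃ Γ' : Set (Eu d), IsOpenCone Γ' ∧ ξ₀ ∈ Γ' ∧
      ∫⁻ b in z ⁻¹' Γ', G b ^ 2 * weight (2 * s) (z b) ∂ν < ⊤ := by
  obtain ⟨Γ', hΓ', hξ₀', c, hc, hsep⟩ := hΓ.exists_narrower hξ₀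
  refine ⟨Γ', hΓ', hξ₀', ?_⟩
  have hym := hμ.measurable
  have hzm := hν.measurable
  have hS : MeasurableSet (y ⁻¹' Γ) := hym hΓ.1.measurableSet
  have hnear : ∫⁻ b, (∫⁻ a in y ⁻¹' Γ, k (z b - y a) * F a ∂μ) ^ 2 * weight (2 * s) (z b) ∂ν < ⊤ := by
    have := lintegral_sq_convolution_lt_top hμ hν hk (hF.indicator hS) s (by
      rw [← lintegral_indicator hS] at hreg
      convert hreg using 3 with a
      by_cases ha : a ∈ y ⁻¹' Γ <;> simp [ha])
    convert this using 5 with b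
    rw [← lintegral_indicator hS]
    refine lintegral_congr fun a => ?_
    by_cases ha : a ∈ y ⁻¹' Γ <;> simp [ha]
  have hfar := lintegral_sq_convolution_far_lt_top hμ hν hk hN hD hFN hΓ'.1.measurableSet hc hsep s
  set P : β → ℝ≥0∞ := fun b => (∫⁻ a in y ⁻¹' Γ, k (z b - y a) * F a ∂μ) ^ 2 *
    weight (2 * s) (z b)
  set Q : β → ℝ≥0∞ := fun b => (∫⁻ a in (y ⁻¹' Γ)ᶜ, k (z b - y a) * F a ∂μ) ^ 2 *
    weight (2 * s) (z b)
  have hmeas : Measurable (Function.uncurry fun (b : β) (a : α) => k (z b - y a) * F a) :=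
    (hkm.comp ((hzm.comp measurable_fst).sub (hym.comp measurable_snd))).mul
      (hF.comp measurable_snd)
  have hPm : Measurable P :=
    (hmeas.lintegral_prod_right'.pow_const 2).mul ((measurable_weight _).comp hzm)
  calc _ ≤ ∫⁻ b in z ⁻¹' Γ', 4 * (P b + Q b) ∂ν := by
        refine lintegral_mono fun b => ?_
        have h := hG b
        rw [← lintegral_add_compl _ hS] at h
        have h' := (pow_le_pow_left₀ zero_le h 2).trans (add_sq_le_four_mul _ _)
        refine (mul_le_mul_left h' (weight (2 * s) (z b))).trans (le_of_eq ?_)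
        simp only [P, Q]; ring
    _ = 4 * (∫⁻ b in z ⁻¹' Γ', P b ∂ν + ∫⁻ b in z ⁻¹' Γ', Q b ∂ν) := by
        rw [lintegral_const_mul' _ _ (by norm_num), lintegral_add_left hPm]
    _ < ⊤ := by
        refine ENNReal.mul_lt_top (by norm_num) (ENNReal.add_lt_top.2 ⟨?_, hfar⟩)
        exact (setLIntegral_le_lintegral _ _).trans_lt hnear

end Cones

/-! ### Fourier transforms of test functions -/

section TestFourier

variable {d : ℕ}

theorem norm_expChar (y x : Eu d) : ‖expChar y x‖ = 1 := by
  rw [expChar, show (2 * Real.pi * Complex.I * (inner ℝ y x : ℝ) : ℂ) =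
    ((2 * Real.pi * inner ℝ y x : ℝ) : ℂ) * Complex.I by push_cast; ring]
  exact Complex.norm_exp_ofReal_mul_I _

theorem expChar_add (y z x : Eu d) : expChar (y + z) x = expChar y x * expChar z x := by
  rw [expChar, expChar, expChar, ← Complex.exp_add, inner_add_left]
  congr 1; push_cast; ring

theorem continuous_expChar_uncurry :
    Continuous (fun p : Eu d × Eu d => expChar p.1 p.2) := by
  unfold expChar; fun_prop

theorem fourier_eq_integral_expChar (g : Eu d → ℂ) (ξ : Eu d) :
    𝓕 g ξ = ∫ x, expChar (-ξ) x * g x := by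
  rw [Real.fourier_eq']
  refine integral_congr_ae (Eventually.of_forall fun x => ?_)
  simp only [expChar, smul_eq_mul, inner_neg_left, real_inner_comm x ξ]
  congr 2; push_cast; ring

theorem fourier_expChar_mul (y : Eu d) (g : Eu d → ℂ) (ξ : Eu d) :
    𝓕 (fun x => expChar y x * g x) ξ = 𝓕 g (ξ - y) := by
  rw [fourier_eq_integral_expChar, fourier_eq_integral_expChar]
  refine integral_congr_ae (Eventually.of_forall fun x => ?_)
  simp only [← mul_assoc, ← expChar_add]
  congr 2; abel

/-- A test function, viewed as a Schwartz function. -/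
noncomputable def toSchwartz (χ : Test d) : SchwartzMap (Eu d) ℂ :=
  χ.hasCompactSupport.toSchwartzMap χ.contDiff

theorem coe_toSchwartz (χ : Test d) : (toSchwartz χ : Eu d → ℂ) = χ := rfl

theorem coe_fourier_toSchwartz (χ : Test d) :
    ((𝓕 (toSchwartz χ) : SchwartzMap (Eu d) ℂ) : Eu d → ℂ) = 𝓕 (χ : Eu d → ℂ) := rfl

theorem continuous_fourier_test (χ : Test d) : Continuous (𝓕 (χ : Eu d → ℂ)) :=
  coe_fourier_toSchwartz χ ▸ (𝓕 (toSchwartz χ)).continuous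

theorem exists_norm_fourier_le (χ : Test d) (M : ℝ) :
    ∃ C : ℝ, 0 ≤ C ∧ ∀ ξ, ‖𝓕 (χ : Eu d → ℂ) ξ‖ ≤ C * bracket ξ ^ (-M) := by
  set k : ℕ := ⌈M⌉₊
  have h := fun ξ => SchwartzMap.one_add_le_sup_seminorm_apply (𝕜 := ℂ) (m := (k, 0)) le_rfl le_rfl
    (𝓕 (toSchwartz χ)) ξ
  simp only [norm_iteratedFDeriv_zero, coe_fourier_toSchwartz] at h
  refine ⟨_, le_trans (by positivity) (h 0), fun ξ => ?_⟩
  have hb := bracket_pos ξ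
  rw [Real.rpow_neg hb.le, ← div_eq_mul_inv, le_div_iff₀ (by positivity), mul_comm]
  refine le_trans ?_ (h ξ)
  gcongr
  calc bracket ξ ^ M ≤ bracket ξ ^ (k : ℝ) :=
        Real.rpow_le_rpow_of_exponent_le (one_le_bracket ξ) (Nat.le_ceil M)
    _ = bracket ξ ^ k := Real.rpow_natCast _ _
    _ ≤ (1 + ‖ξ‖) ^ k := pow_le_pow_left₀ hb.le (bracket_le_one_add_norm ξ) _

theorem integrable_bracket_mul_fourier (χ : Test d) (N : ℝ) :
    Integrable (fun ξ => bracket ξ ^ N * ‖𝓕 (χ : Eu d → ℂ) ξ‖) := by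
  obtain ⟨C, hC, h⟩ := exists_norm_fourier_le χ (N + (d + 1))
  refine (integrable_bracket_rpow.const_mul C).mono'
    ((continuous_bracket_rpow N).mul (continuous_fourier_test χ).norm).aestronglyMeasurable
    (Eventually.of_forall fun ξ => ?_)
  have hb := bracket_pos ξ
  rw [Real.norm_of_nonneg (by positivity)]
  calc bracket ξ ^ N * ‖𝓕 (χ : Eu d → ℂ) ξ‖
      ≤ bracket ξ ^ N * (C * bracket ξ ^ (-(N + (d + 1)))) := by gcongr; exact h ξ
    _ = C * (bracket ξ ^ N * bracket ξ ^ (-(N + (d + 1)))) := by ring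
    _ = _ := by rw [← Real.rpow_add hb]; congr 2; ring

theorem fourierInv_fourier_test (χ : Test d) (x : Eu d) :
    χ x = ∫ ξ, 𝓕 (χ : Eu d → ℂ) ξ * expChar ξ x := by
  have h : 𝓕⁻ (𝓕 (toSchwartz χ)) = toSchwartz χ := FourierPair.fourierInv_fourier_eq _
  have h' := congrArg (fun g : SchwartzMap (Eu d) ℂ => g x) h
  simp only [SchwartzMap.fourierInv_coe, coe_fourier_toSchwartz] at h'
  rw [← coe_toSchwartz, ← h', Real.fourierInv_eq']
  refine integral_congr_ae (Eventually.of_forall fun ξ => ?_)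
  simp only [expChar, smul_eq_mul]
  rw [mul_comm]; congr 2; push_cast; ring

theorem norm_iteratedFDeriv_test_le (χ : Test d) {i N : ℕ} (hi : i ≤ N) (x : Eu d) :
    ‖iteratedFDeriv ℝ i χ x‖ ≤
      (2 * Real.pi) ^ i * (i + 1) * ∫ ξ, bracket ξ ^ (N : ℝ) * ‖𝓕 (χ : Eu d → ℂ) ξ‖ := by
  set g : SchwartzMap (Eu d) ℂ := 𝓕 (toSchwartz χ) with hg
  have e : (χ : Eu d → ℂ) = fun x => 𝓕 (g : Eu d → ℂ) (-x) := by
    have h : 𝓕⁻ g = toSchwartz χ := FourierPair.fourierInv_fourier_eq _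
    rw [← coe_toSchwartz, ← h, SchwartzMap.fourierInv_coe]
    ext x
    exact Real.fourierInv_eq_fourier_neg _ _
  have h1 := Real.pow_mul_norm_iteratedFDeriv_fourier_le (K := ⊤) (N := 0) (f := g) (k := i) (n := 0)
    (g.smooth _) (fun k n _ _ => g.integrable_pow_mul_iteratedFDeriv volume k n) le_top le_rfl (-x)
  have h2 : ‖iteratedFDeriv ℝ i χ x‖ = ‖iteratedFDeriv ℝ i (𝓕 (g : Eu d → ℂ)) (-x)‖ := by
    rw [e]
    exact (LinearIsometryEquiv.neg ℝ (E := Eu d)).norm_iteratedFDeriv_comp_right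
      (𝓕 (g : Eu d → ℂ)) x i
  rw [h2]
  simp only [pow_zero, one_mul, mul_one, zero_add, Finset.range_one, Finset.product_singleton,
    Finset.sum_map, Function.Embedding.coeFn_mk, norm_iteratedFDeriv_zero] at h1
  refine h1.trans ?_
  rw [mul_assoc]
  gcongr
  calc ∑ p ∈ Finset.range (i + 1), ∫ v, ‖v‖ ^ p * ‖g v‖
      ≤ ∑ p ∈ Finset.range (i + 1), ∫ ξ, bracket ξ ^ (N : ℝ) * ‖𝓕 (χ : Eu d → ℂ) ξ‖ := by
        refine Finset.sum_le_sum fun p hp => ?_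
        refine integral_mono (g.integrable_pow_mul volume p)
          (integrable_bracket_mul_fourier χ N) fun v => ?_
        have hp' : p ≤ N := (Nat.lt_succ_iff.1 (Finset.mem_range.1 hp)).trans hi
        refine mul_le_mul_of_nonneg_right ?_ (norm_nonneg (g v))
        calc ‖v‖ ^ p ≤ bracket v ^ p := pow_le_pow_left₀ (norm_nonneg _) (norm_le_bracket v) _
          _ ≤ bracket v ^ N := pow_le_pow_right₀ (one_le_bracket v) hp'
          _ = _ := (Real.rpow_natCast _ _).symm
    _ = _ := by simp

end TestFourier

/-! ### Fourier representation of distributions on compact sets -/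

section Representation

variable {d : ℕ}

theorem memLp_two_bracket_rpow :
    MemLp (fun ξ : Eu d => bracket ξ ^ (-((d : ℝ) + 1))) 2 := by
  rw [memLp_two_iff_integrable_sq (continuous_bracket_rpow _).aestronglyMeasurable]
  refine integrable_bracket_rpow.mono' ((continuous_bracket_rpow _).pow 2).aestronglyMeasurable
    (Eventually.of_forall fun ξ => ?_)
  have hb := bracket_pos ξ
  rw [Real.norm_of_nonneg (by positivity), pow_two]
  refine mul_le_of_le_one_left (by positivity) ?_
  exact Real.rpow_le_one_of_one_le_of_nonpos (one_le_bracket ξ) (by linarith [(Nat.cast_nonneg d : (0 : ℝ) ≤ d)])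

theorem hasTemperateGrowth_bracket_rpow (t : ℝ) :
    Function.HasTemperateGrowth (fun ξ : Eu d => ((bracket ξ ^ t : ℝ) : ℂ)) := by
  have e : (fun ξ : Eu d => bracket ξ ^ t) = fun ξ => (1 + ‖ξ‖ ^ 2) ^ (t / 2) := by
    ext ξ
    rw [bracket, Real.sqrt_eq_rpow, ← Real.rpow_mul (by positivity)]
    congr 1; ring
  have h : Function.HasTemperateGrowth (fun ξ : Eu d => bracket ξ ^ t) := by
    rw [e]; exact Function.hasTemperateGrowth_one_add_norm_sq_rpow _ _
  exact Function.Complex.hasTemperateGrowth_ofReal.comp h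

/-- A function supported in a fixed compact set, as a test function. -/
noncomputable def ofSupportedInTop {K : Compacts (Eu d)} (χ : 𝓓_{K}(Eu d, ℂ)) : Test d :=
  TestFunction.ofSupportedIn (fun _ _ => trivial) χ

/-- The weighted Fourier transform `χ ↦ ⟨·⟩ ^ t · 𝓕 χ`, from the smooth functions supported in `K`
to `L²`. -/
noncomputable def weightedFourier (K : Compacts (Eu d)) (t : ℝ) :
    𝓓_{K}(Eu d, ℂ) →ₗ[ℂ] Lp ℂ 2 (volume : Measure (Eu d)) :=
  (SchwartzMap.toLpCLM ℂ ℂ 2 volume ∘L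
    SchwartzMap.smulLeftCLM ℂ (fun ξ : Eu d => ((bracket ξ ^ t : ℝ) : ℂ)) ∘L
    SchwartzMap.fourierTransformCLM ℂ).toLinearMap ∘ₗ
  { toFun := fun χ => toSchwartz (ofSupportedInTop χ)
    map_add' := fun _ _ => rfl
    map_smul' := fun _ _ => rfl }

theorem coeFn_weightedFourier (K : Compacts (Eu d)) (t : ℝ) (χ : 𝓓_{K}(Eu d, ℂ)) :
    weightedFourier K t χ =ᵐ[volume] fun ξ => ((bracket ξ ^ t : ℝ) : ℂ) * 𝓕 (χ : Eu d → ℂ) ξ := by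
  refine (SchwartzMap.coeFn_toLp _ 2 volume).trans (Eventually.of_forall fun ξ => ?_)
  exact SchwartzMap.smulLeftCLM_apply_apply (hasTemperateGrowth_bracket_rpow t) _ _

theorem integral_bracket_mul_fourier_le (K : Compacts (Eu d)) (N : ℝ) :
    ∃ C : ℝ, 0 ≤ C ∧ ∀ χ : 𝓓_{K}(Eu d, ℂ),
      ∫ ξ, bracket ξ ^ N * ‖𝓕 (χ : Eu d → ℂ) ξ‖ ≤ C * ‖weightedFourier K (N + (d + 1)) χ‖ := by
  refine ⟨(∫ ξ : Eu d, ‖bracket ξ ^ (-((d : ℝ) + 1))‖ ^ (2 : ℝ)) ^ (1 / 2 : ℝ),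
    by positivity, fun χ => ?_⟩
  set h := weightedFourier K (N + (d + 1)) χ with hh
  have h2 : MemLp (fun ξ => ‖h ξ‖) (ENNReal.ofReal 2) := by simpa using (Lp.memLp h).norm
  have h1 : MemLp (fun ξ : Eu d => bracket ξ ^ (-((d : ℝ) + 1))) (ENNReal.ofReal 2) := by
    simpa using memLp_two_bracket_rpow
  have key := integral_mul_norm_le_Lp_mul_Lq Real.HolderConjugate.two_two h1 h2
  simp only [norm_norm] at key
  have hn : ‖h‖ = (∫ ξ, ‖h ξ‖ ^ (2 : ℝ)) ^ (1 / 2 : ℝ) := by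
    rw [Lp.norm_def, MemLp.eLpNorm_eq_integral_rpow_norm (by norm_num) (by norm_num) (Lp.memLp h),
      ENNReal.toReal_ofReal (by positivity)]
    norm_num
  rw [hn]
  refine le_trans (le_of_eq (integral_congr_ae ?_)) key
  filter_upwards [coeFn_weightedFourier K (N + (d + 1)) χ] with ξ hξ
  have hb := bracket_pos ξ
  rw [hh, hξ, norm_mul, Complex.norm_real, Real.norm_of_nonneg (by positivity),
    Real.norm_of_nonneg (by positivity), ← mul_assoc, ← Real.rpow_add hb]
  congr 2; ring

/-- A distribution is bounded on the smooth functions supported in a fixed compact set by a weighted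
`L²`-norm of the Fourier transform. -/
theorem exists_norm_apply_le_weightedFourier (f : Distrib d) (K : Compacts (Eu d)) :
    ∃ t C : ℝ, 0 ≤ t ∧ ∀ χ : 𝓓_{K}(Eu d, ℂ),
      ‖f (ofSupportedInTop χ)‖ ≤ C * ‖weightedFourier K t χ‖ := by
  set fK : 𝓓_{K}(Eu d, ℂ) →L[ℂ] ℂ :=
    f.comp (TestFunction.ofSupportedInCLM ℂ (Ω := ⊤) (K := K) (fun _ _ => trivial))
  have hws := ContDiffMapSupportedIn.withSeminorms ℂ (Eu d) ℂ ⊤ K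
  obtain ⟨S, A, -, hA⟩ := Seminorm.bound_of_continuous hws
    ((normSeminorm ℂ ℂ).comp fK.toLinearMap) (continuous_norm.comp fK.continuous)
  set N : ℕ := S.sup id
  obtain ⟨C, hC, hCb⟩ := integral_bracket_mul_fourier_le K (N : ℝ)
  set B : ℝ := (2 * Real.pi) ^ N * (N + 1)
  refine ⟨N + (d + 1), A * (B * C), by positivity, fun χ => (hA χ).trans ?_⟩
  have hsup : (S.sup (ContDiffMapSupportedIn.seminorm ℂ (Eu d) ℂ ⊤ K)) χ ≤
      B * C * ‖weightedFourier K (N + (d + 1)) χ‖ := by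
    refine Seminorm.finset_sup_apply_le (by positivity) fun i hi => ?_
    have hiN : i ≤ N := Finset.le_sup (f := id) hi
    refine (ContDiffMapSupportedIn.seminorm_top_le_iff ℂ (by positivity) i χ).2 fun x _ => ?_
    refine (norm_iteratedFDeriv_test_le (ofSupportedInTop χ) hiN x).trans ?_
    have hp : 1 ≤ 2 * Real.pi := by linarith [Real.pi_gt_three]
    calc _ ≤ B * ∫ ξ, bracket ξ ^ (N : ℝ) * ‖𝓕 (χ : Eu d → ℂ) ξ‖ := by
          have h0 : 0 ≤ ∫ ξ, bracket ξ ^ (N : ℝ) * ‖𝓕 (χ : Eu d → ℂ) ξ‖ :=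
            integral_nonneg fun ξ => mul_nonneg (Real.rpow_nonneg (bracket_pos ξ).le _)
              (norm_nonneg _)
          refine mul_le_mul_of_nonneg_right ?_ h0
          simp only [B]
          gcongr
      _ ≤ _ := by
          rw [mul_assoc B]
          exact mul_le_mul_of_nonneg_left (hCb χ) (by positivity)
  calc _ ≤ (A : ℝ) * (B * C * ‖weightedFourier K (N + (d + 1)) χ‖) :=
        mul_le_mul_of_nonneg_left hsup A.2
    _ = _ := by ring

/-- On the test functions supported in a fixed compact set, a distribution acts through the Fourier
transform as integration against a function of polynomial growth in the mean. The function comes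
from the Riesz representation theorem, applied to the closure of the range of the weighted Fourier
transform. -/
theorem exists_fourier_representation (f : Distrib d) (K : Compacts (Eu d)) :
    ∃ (b : Eu d → ℂ) (N : ℝ), 0 ≤ N ∧ StronglyMeasurable b ∧
      Integrable (fun ξ => ‖b ξ‖ * bracket ξ ^ (-N)) ∧
      ∀ χ : Test d, tsupport χ ⊆ K → f χ = ∫ ξ, 𝓕 (χ : Eu d → ℂ) ξ * b ξ := by
  obtain ⟨t, C, ht, hC⟩ := exists_norm_apply_le_weightedFourier f K
  set T := weightedFourier K t
  set H := (LinearMap.range T).topologicalClosure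
  set e : 𝓓_{K}(Eu d, ℂ) →ₗ[ℂ] H :=
    T.codRestrict H fun χ => Submodule.le_topologicalClosure _ ⟨χ, rfl⟩
  have he : DenseRange e := by
    intro x
    rw [closure_subtype]
    have hx : (x : Lp ℂ 2 (volume : Measure (Eu d))) ∈ closure (Set.range T) := x.2
    convert hx using 1
    congr 1
    ext u
    simp only [mem_image, mem_range]
    constructor
    · rintro ⟨_, ⟨χ, rfl⟩, rfl⟩; exact ⟨χ, rfl⟩
    · rintro ⟨χ, rfl⟩; exact ⟨_, ⟨χ, rfl⟩, rfl⟩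
  set fK : 𝓓_{K}(Eu d, ℂ) →ₗ[ℂ] ℂ := (f.comp
    (TestFunction.ofSupportedInCLM ℂ (Ω := ⊤) (K := K) (fun _ _ => trivial))).toLinearMap
  have hext := LinearMap.extendOfNorm_eq (f := fK) he ⟨C, hC⟩
  set h : H := (InnerProductSpace.toDual ℂ H).symm (fK.extendOfNorm e)
  set h' : Lp ℂ 2 (volume : Measure (Eu d)) := h.1
  have hrep : ∀ χ : 𝓓_{K}(Eu d, ℂ), f (ofSupportedInTop χ) = inner ℂ h' (T χ) := fun χ => by
    have h1 : inner ℂ h (e χ) = fK.extendOfNorm e (e χ) :=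
      InnerProductSpace.toDual_symm_apply
    rw [hext] at h1
    exact h1.symm
  refine ⟨fun ξ => (starRingEnd ℂ) (h' ξ) * ((bracket ξ ^ t : ℝ) : ℂ), t + (d + 1), by positivity,
    ?_, ?_, ?_⟩
  · exact (Complex.continuous_conj.comp_stronglyMeasurable (Lp.stronglyMeasurable h')).mul
      (Complex.continuous_ofReal.comp (continuous_bracket_rpow t)).stronglyMeasurable
  · have hi := (Lp.memLp h').norm.integrable_mul (p := 2) (q := 2) (memLp_two_bracket_rpow (d := d))
    refine hi.congr (Eventually.of_forall fun ξ => ?_)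
    have hb := bracket_pos ξ
    simp only [Pi.mul_apply, norm_mul, Complex.norm_real, RCLike.norm_conj]
    rw [Real.norm_of_nonneg (by positivity), mul_assoc, ← Real.rpow_add hb]
    congr 2; ring
  · intro χ hχ
    set χ' : 𝓓_{K}(Eu d, ℂ) := ⟨χ, χ.contDiff, fun x hx =>
      image_eq_zero_of_notMem_tsupport fun h => hx (hχ h)⟩
    have h1 := hrep χ'
    have h2 : ofSupportedInTop χ' = χ := rfl
    rw [h2, L2.inner_def] at h1
    rw [h1]
    refine integral_congr_ae ?_
    filter_upwards [coeFn_weightedFourier K t χ'] with ξ hξ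
    rw [RCLike.inner_apply, hξ]
    have h3 : 𝓕 (χ' : Eu d → ℂ) ξ = 𝓕 (χ : Eu d → ℂ) ξ := rfl
    rw [h3]; ring

end Representation

/-! ### Superpositions of characters -/

section Superposition

variable {d : ℕ}

theorem bracket_rpow_neg_sub_le {N : ℝ} (hN : 0 ≤ N) (ξ η : Eu d) :
    bracket (ξ - η) ^ (-N) ≤ 2 ^ N * bracket ξ ^ (-N) * bracket η ^ N := by
  have h := bracket_rpow_le (-N) (ξ - η) ξ
  rwa [abs_neg, abs_of_nonneg hN, sub_sub_cancel_left, bracket_neg] at h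

theorem tsupport_mulTest_subset (g : Eu d → ℂ) (hg : ContDiff ℝ ∞ g) (φ : Test d) :
    tsupport (mulTest g hg φ) ⊆ tsupport φ :=
  closure_mono (Function.support_mul_subset_right g φ)

/-- The function representing `f` on the support of `φ` also represents the Fourier transform of
`φ f`, as a convolution. -/
theorem exists_fourierLocalized_representation (φ : Test d) (f : Distrib d) :
    ∃ (b : Eu d → ℂ) (N : ℝ), 0 ≤ N ∧ StronglyMeasurable b ∧
      Integrable (fun ξ => ‖b ξ‖ * bracket ξ ^ (-N)) ∧
      (∀ χ : Test d, tsupport χ ⊆ tsupport φ → f χ = ∫ ξ, 𝓕 (χ : Eu d → ℂ) ξ * b ξ) ∧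
      ∀ η, fourierLocalized φ f η = ∫ ξ, 𝓕 (φ : Eu d → ℂ) (ξ + η) * b ξ := by
  obtain ⟨b, N, hN, hbm, hbi, hb⟩ :=
    exists_fourier_representation f ⟨tsupport φ, φ.hasCompactSupport⟩
  refine ⟨b, N, hN, hbm, hbi, hb, fun η => ?_⟩
  rw [fourierLocalized, hb _ (tsupport_mulTest_subset _ _ φ)]
  refine integral_congr_ae (Eventually.of_forall fun ξ => ?_)
  have h := fourier_expChar_mul (-η) φ ξ
  rw [sub_neg_eq_add] at h
  exact congrArg (· * b ξ) h

theorem measurable_fourierLocalized (φ : Test d) (f : Distrib d) :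
    Measurable (fourierLocalized φ f) := by
  obtain ⟨b, N, -, hbm, -, -, h⟩ := exists_fourierLocalized_representation φ f
  rw [funext h]
  refine (StronglyMeasurable.integral_prod_right
    (f := fun η ξ => 𝓕 (φ : Eu d → ℂ) (ξ + η) * b ξ) ?_).measurable
  exact ((continuous_fourier_test φ).comp
    (continuous_snd.add continuous_fst)).stronglyMeasurable.mul
    (hbm.comp_measurable measurable_snd)

theorem exists_norm_fourierLocalized_le (φ : Test d) (f : Distrib d) :
    ∃ C N : ℝ, 0 ≤ C ∧ 0 ≤ N ∧ ∀ η, ‖fourierLocalized φ f η‖ ≤ C * bracket η ^ N := by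
  obtain ⟨b, N, hN, hbm, hbi, -, h⟩ := exists_fourierLocalized_representation φ f
  obtain ⟨C, hC, hφ⟩ := exists_norm_fourier_le φ N
  have h0 : 0 ≤ ∫ ξ, ‖b ξ‖ * bracket ξ ^ (-N) := integral_nonneg fun ξ =>
    mul_nonneg (norm_nonneg _) (Real.rpow_nonneg (bracket_pos ξ).le _)
  refine ⟨C * 2 ^ N * ∫ ξ, ‖b ξ‖ * bracket ξ ^ (-N), N, by positivity, hN, fun η => ?_⟩
  rw [h η]
  have hη := bracket_pos η
  calc _ ≤ ∫ ξ, C * 2 ^ N * bracket η ^ N * (‖b ξ‖ * bracket ξ ^ (-N)) := by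
        refine norm_integral_le_of_norm_le (hbi.const_mul _) (Eventually.of_forall fun ξ => ?_)
        rw [norm_mul]
        have h1 := bracket_rpow_neg_sub_le hN ξ (-η)
        rw [sub_neg_eq_add, bracket_neg] at h1
        calc _ ≤ C * (2 ^ N * bracket ξ ^ (-N) * bracket η ^ N) * ‖b ξ‖ := by
              gcongr; exact (hφ _).trans (by gcongr)
          _ = _ := by ring
    _ = _ := by rw [integral_const_mul]; ring

/-- A distribution may be evaluated under the integral sign: if `χ = φ ∫ c(i) e_{y(i)} dμ(i)` is
a superposition of characters cut off by `φ`, with rapidly decreasing coefficients `c`, then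
`⟨f, χ⟩ = ∫ c(i) ⟨f, φ e_{y(i)}⟩ dμ(i)`. -/
theorem apply_eq_integral_fourierLocalized (f : Distrib d) (φ χ : Test d) {ι : Type*}
    [MeasurableSpace ι] {μ : Measure ι} [SFinite μ] {y : ι → Eu d} (hy : Measurable y) {c : ι → ℂ}
    (hc : StronglyMeasurable c) (hci : ∀ N : ℝ, Integrable (fun i => ‖c i‖ * bracket (y i) ^ N) μ)
    (hχ : ∀ x, χ x = φ x * ∫ i, c i * expChar (y i) x ∂μ) :
    f χ = ∫ i, c i * fourierLocalized φ f (-y i) ∂μ := by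
  obtain ⟨b, N, hN, hbm, hbi, hfb, hF⟩ := exists_fourierLocalized_representation φ f
  obtain ⟨C, hC, hφ⟩ := exists_norm_fourier_le φ N
  have hci0 : Integrable (fun i => ‖c i‖) μ := by simpa using hci 0
  have hφi : Integrable (fun x => ‖φ x‖) :=
    (φ.continuous.integrable_of_hasCompactSupport φ.hasCompactSupport).norm
  have hsupp : tsupport χ ⊆ tsupport φ := by
    refine closure_mono fun x hx hφx => hx ?_
    rw [hχ, hφx, zero_mul]
  have hFχ : ∀ ξ, 𝓕 (χ : Eu d → ℂ) ξ = ∫ i, c i * 𝓕 (φ : Eu d → ℂ) (ξ - y i) ∂μ := fun ξ => by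
    have hint : Integrable (Function.uncurry fun (x : Eu d) (i : ι) =>
        expChar (-ξ) x * φ x * (c i * expChar (y i) x)) (volume.prod μ) := by
      have h1 := hφi.mul_prod hci0
      refine h1.mono' ?_ (Eventually.of_forall fun p => ?_)
      · have e1 : Measurable fun p : Eu d × ι => expChar (-ξ) p.1 :=
          (contDiff_expChar (-ξ)).continuous.measurable.comp measurable_fst
        have e2 : Measurable fun p : Eu d × ι => expChar (y p.2) p.1 :=
          Measurable.comp (g := fun q : Eu d × Eu d => expChar q.1 q.2)
            (f := fun p : Eu d × ι => (y p.2, p.1)) continuous_expChar_uncurry.measurable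
            ((hy.comp measurable_snd).prodMk measurable_fst)
        exact ((e1.mul (φ.continuous.measurable.comp measurable_fst)).mul
          ((hc.measurable.comp measurable_snd).mul e2)).aestronglyMeasurable
      · simp [Function.uncurry, norm_expChar]
    calc 𝓕 (χ : Eu d → ℂ) ξ
        = ∫ x, ∫ i, expChar (-ξ) x * φ x * (c i * expChar (y i) x) ∂μ := by
          rw [fourier_eq_integral_expChar]
          refine integral_congr_ae (Eventually.of_forall fun x => ?_)
          simp only [hχ, ← integral_const_mul, mul_assoc]
      _ = ∫ i, (∫ x, expChar (-ξ) x * φ x * (c i * expChar (y i) x)) ∂μ :=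
          integral_integral_swap hint
      _ = _ := by
          refine integral_congr_ae (Eventually.of_forall fun i => ?_)
          dsimp only
          rw [fourier_eq_integral_expChar, ← integral_const_mul]
          refine integral_congr_ae (Eventually.of_forall fun x => ?_)
          dsimp only
          rw [show -(ξ - y i) = -ξ + y i by abel, expChar_add]
          ring
  rw [hfb χ hsupp]
  have hint : Integrable (Function.uncurry fun (ξ : Eu d) (i : ι) =>
      c i * 𝓕 (φ : Eu d → ℂ) (ξ - y i) * b ξ) (volume.prod μ) := by
    have h1 := (hbi.mul_prod (hci N)).const_mul (C * 2 ^ N)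
    refine h1.mono' ?_ (Eventually.of_forall fun p => ?_)
    · exact (((hc.measurable.comp measurable_snd).mul ((continuous_fourier_test φ).measurable.comp
        (measurable_fst.sub (hy.comp measurable_snd)))).mul
        (hbm.measurable.comp measurable_fst)).aestronglyMeasurable
    · simp only [Function.uncurry, norm_mul]
      calc _ ≤ ‖c p.2‖ * (C * (2 ^ N * bracket p.1 ^ (-N) * bracket (y p.2) ^ N)) * ‖b p.1‖ := by
            gcongr
            refine (hφ _).trans ?_
            gcongr
            exact bracket_rpow_neg_sub_le hN _ _
        _ = _ := by ring
  calc _ = ∫ ξ, ∫ i, c i * 𝓕 (φ : Eu d → ℂ) (ξ - y i) * b ξ ∂μ := by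
        refine integral_congr_ae (Eventually.of_forall fun ξ => ?_)
        simp only [hFχ, integral_mul_const]
    _ = ∫ i, (∫ ξ, c i * 𝓕 (φ : Eu d → ℂ) (ξ - y i) * b ξ) ∂μ := integral_integral_swap hint
    _ = _ := by
        refine integral_congr_ae (Eventually.of_forall fun i => ?_)
        dsimp only
        rw [hF, ← integral_const_mul]
        simp only [mul_assoc, sub_eq_add_neg]

end Superposition

/-! ### Poisson summation on the integer lattice -/

section Poisson

variable {d : ℕ}

theorem latticePt_neg (n : Fin d → ℤ) : latticePt (-n) = -latticePt n := by
  ext i; simp [latticePt]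

theorem latticePt_sub (m n : Fin d → ℤ) : latticePt (m - n) = latticePt m - latticePt n := by
  ext i; simp [latticePt]

theorem latticePt_apply (n : Fin d → ℤ) (i : Fin d) : latticePt n i = n i := rfl

theorem expChar_latticePt (n : Fin d → ℤ) (x : Eu d) :
    expChar (latticePt n) x = ∏ i, Complex.exp (2 * Real.pi * Complex.I * (n i * x i)) := by
  rw [expChar, ← Complex.exp_sum, ← Finset.mul_sum, PiLp.inner_apply]
  congr 2
  push_cast
  refine Finset.sum_congr rfl fun i _ => ?_
  simp [latticePt, mul_comm]

theorem expChar_latticePt_add_latticePt (m n : Fin d → ℤ) (x : Eu d) :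
    expChar (latticePt m) (x + latticePt n) = expChar (latticePt m) x := by
  rw [expChar_latticePt, expChar_latticePt]
  refine Finset.prod_congr rfl fun i _ => ?_
  refine Complex.exp_eq_exp_iff_exists_int.2 ⟨m i * n i, ?_⟩
  simp only [PiLp.add_apply, latticePt_apply]
  push_cast
  ring

/-- The integral over `ℝ^d` of an integrable function is the integral over the unit cell of its
periodization. -/
theorem setIntegral_cell_tsum {h : Eu d → ℂ} (hh : Integrable h) :
    ∫ x in cell (0 : Fin d → ℤ), ∑' k, h (x + latticePt k) = ∫ x, h x := by
  have hmp : ∀ k : Fin d → ℤ, MeasurePreserving (fun x : Eu d => x + latticePt k) :=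
    fun k => measurePreserving_add_right _ _
  have hemb : ∀ k : Fin d → ℤ, MeasurableEmbedding (fun x : Eu d => x + latticePt k) :=
    fun k => (MeasurableEquiv.addRight (latticePt k)).measurableEmbedding
  have hpre : ∀ k : Fin d → ℤ, (fun x : Eu d => x + latticePt k) ⁻¹' cell k = cell 0 := fun k => by
    ext x
    refine forall_congr' fun i => ?_
    have e : (x + latticePt k) i = x i + k i := rfl
    simp only [e, mem_Ioc, Pi.zero_apply, Int.cast_zero]
    constructor <;> rintro ⟨h1, h2⟩ <;> constructor <;> linarith
  have hset : ∀ {E : Type} [NormedAddCommGroup E] [NormedSpace ℝ E] (g : Eu d → E)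
      (k : Fin d → ℤ), ∫ x in cell 0, g (x + latticePt k) = ∫ x in cell k, g x := fun g k => by
    rw [← hpre k]
    exact (hmp k).setIntegral_preimage_emb (hemb k) g (cell k)
  have hsum : ∀ {E : Type} [NormedAddCommGroup E] [NormedSpace ℝ E] {g : Eu d → E},
      Integrable g → HasSum (fun k => ∫ x in cell k, g x) (∫ x, g x) := fun {E} _ _ {g} hg => by
    have := hasSum_integral_iUnion (μ := volume) measurableSet_cell pairwise_disjoint_cell
      (f := g) (hg.integrableOn)
    rwa [iUnion_cell, setIntegral_univ] at this
  have h1 := hasSum_integral_of_summable_integral_norm (μ := volume.restrict (cell 0))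
    (F := fun k x => h (x + latticePt k))
    (fun k => ((hmp k).integrable_comp_of_integrable hh).integrableOn)
    (by
      refine (hsum hh.norm).summable.congr fun k => ?_
      exact (hset (fun x => ‖h x‖) k).symm)
  refine h1.unique ?_
  simp only [hset]
  exact hsum hh

/-- The periodization of a test function is locally a finite sum. -/
theorem finite_periodization (χ : Test d) (K : Compacts (Eu d)) :
    ∃ S : Finset (Fin d → ℤ), ∀ x ∈ (K : Set (Eu d)), ∀ k ∉ S, χ (x - latticePt k) = 0 := by
  refine ⟨((finite_translates χ K).preimage neg_injective.injOn).toFinset, fun x hx k hk => ?_⟩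
  by_contra h
  refine hk ?_
  rw [Set.Finite.mem_toFinset]
  refine ⟨x, hx, ?_⟩
  rw [latticePt_neg, ← sub_eq_add_neg]
  exact subset_tsupport _ h

theorem continuous_periodization (χ : Test d) :
    Continuous fun x => ∑' k, χ (x - latticePt k) := by
  refine continuous_iff_continuousAt.2 fun x => ?_
  obtain ⟨S, hS⟩ := finite_periodization χ ⟨Metric.closedBall x 1, isCompact_closedBall x 1⟩
  have h : (fun x => ∑' k, χ (x - latticePt k)) =ᶠ[𝓝 x] fun x => ∑ k ∈ S, χ (x - latticePt k) := by
    filter_upwards [Metric.closedBall_mem_nhds x one_pos] with z hz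
    exact tsum_eq_sum fun k hk => hS z hz k hk
  refine ContinuousAt.congr ?_ h.symm
  refine Continuous.continuousAt ?_
  exact continuous_finsetSum _ fun k _ => χ.continuous.comp (continuous_id.sub continuous_const)

theorem periodization_add_latticePt (χ : Test d) (x : Eu d) (n : Fin d → ℤ) :
    ∑' k, χ (x + latticePt n - latticePt k) = ∑' k, χ (x - latticePt k) := by
  rw [← (Equiv.addRight n).tsum_eq]
  refine tsum_congr fun k => ?_
  congr 1
  have : latticePt (k + n) = latticePt k + latticePt n := by ext i; simp [latticePt]
  rw [Equiv.coe_addRight, this]; abel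

/-- The projection of `ℝ^d` onto the torus. -/
def torusMk (x : Fin d → ℝ) : UnitAddTorus (Fin d) := fun i => (x i : UnitAddCircle)

theorem isOpenQuotientMap_torusMk : IsOpenQuotientMap (torusMk (d := d)) :=
  IsOpenQuotientMap.piMap fun _ => QuotientAddGroup.isOpenQuotientMap_mk

theorem exists_add_latticePt_of_torusMk_eq {x z : Fin d → ℝ} (h : torusMk x = torusMk z) :
    ∃ n : Fin d → ℤ, WithLp.toLp 2 z = WithLp.toLp 2 x + latticePt n := by
  have h' : ∀ i, ∃ n : ℤ, z i = x i + n := fun i => by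
    have h1 : (x i : UnitAddCircle) = (z i : UnitAddCircle) := congrFun h i
    obtain ⟨n, hn⟩ := AddSubgroup.mem_zmultiples_iff.1 (QuotientAddGroup.eq.1 h1)
    refine ⟨n, ?_⟩
    rw [zsmul_one] at hn
    linarith
  choose n hn using h'
  exact ⟨n, by ext i; simp [hn i, latticePt]⟩

/-- The periodization of a test function as a continuous function on the torus. -/
theorem exists_torus_lift (χ : Test d) : ∃ g : C(UnitAddTorus (Fin d), ℂ),
    ∀ x, g (torusMk x) = ∑' k, χ (WithLp.toLp 2 x - latticePt k) := by
  set r := Function.surjInv (isOpenQuotientMap_torusMk (d := d)).surjective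
  have hr : ∀ t, torusMk (r t) = t := Function.surjInv_eq _
  have key : ∀ x, ∑' k, χ (WithLp.toLp 2 (r (torusMk x)) - latticePt k) =
      ∑' k, χ (WithLp.toLp 2 x - latticePt k) := fun x => by
    obtain ⟨n, hn⟩ := exists_add_latticePt_of_torusMk_eq (hr (torusMk x)).symm
    rw [hn, periodization_add_latticePt]
  refine ⟨⟨fun t => ∑' k, χ (WithLp.toLp 2 (r t) - latticePt k), ?_⟩, key⟩
  rw [← isOpenQuotientMap_torusMk.continuous_comp_iff]
  have e : (fun t => ∑' k, χ (WithLp.toLp 2 (r t) - latticePt k)) ∘ torusMk =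
      (fun x : Eu d => ∑' k, χ (x - latticePt k)) ∘ (WithLp.toLp 2) := funext key
  rw [e]
  exact (continuous_periodization χ).comp (PiLp.continuous_toLp 2 _)

theorem mFourier_torusMk (n : Fin d → ℤ) (x : Fin d → ℝ) :
    UnitAddTorus.mFourier n (torusMk x) = expChar (latticePt n) (WithLp.toLp 2 x) := by
  rw [expChar_latticePt]
  change ∏ i, fourier (n i) (torusMk x i) = _
  refine Finset.prod_congr rfl fun i _ => ?_
  rw [torusMk, fourier_coe_apply]
  congr 1; push_cast; ring

theorem integrable_lattice_of_decay {E : Type*} [NormedAddCommGroup E] {c : (Fin d → ℤ) → E} {C : ℝ} {M : ℝ}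
    (hM : (d : ℝ) + 1 ≤ M) (hc : ∀ n, ‖c n‖ ≤ C * bracket (latticePt n) ^ (-M)) :
    Integrable c Measure.count := by
  obtain ⟨A, hA, hAb⟩ := (boundedDensity_lattice (d := d)).bound
  have h0 := hAb 0
  have hw : Integrable (fun n : Fin d → ℤ => bracket (latticePt n) ^ (-((d : ℝ) + 1)))
      Measure.count := by
    refine ⟨(measurable_of_countable _).aestronglyMeasurable, ?_⟩
    rw [hasFiniteIntegral_iff_ofReal (Eventually.of_forall fun n =>
      Real.rpow_nonneg (bracket_pos _).le _)]
    refine lt_of_le_of_lt ?_ (h0.trans_lt hA.lt_top)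
    refine lintegral_mono fun n => ?_
    rw [zero_sub, weight_neg_arg]
    rfl
  have hC : 0 ≤ C := by
    have := (norm_nonneg _).trans (hc 0)
    exact nonneg_of_mul_nonneg_left this (Real.rpow_pos_of_pos (bracket_pos _) _)
  refine (hw.const_mul C).mono' StronglyMeasurable.of_discrete.aestronglyMeasurable
    (Eventually.of_forall fun n => (hc n).trans ?_)
  gcongr
  exact one_le_bracket _

theorem summable_fourier_lattice (χ : Test d) :
    Summable fun n : Fin d → ℤ => ‖𝓕 (χ : Eu d → ℂ) (latticePt n)‖ := by
  obtain ⟨C, hC, h⟩ := exists_norm_fourier_le χ ((d : ℝ) + 1)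
  exact integrable_count_iff.1 (integrable_lattice_of_decay le_rfl fun n => h (latticePt n))

/-- The Poisson summation formula for test functions. -/
theorem hasSum_poisson (χ : Test d) (x : Eu d) :
    HasSum (fun n : Fin d → ℤ => 𝓕 (χ : Eu d → ℂ) (latticePt n) * expChar (latticePt n) x)
      (∑' k, χ (x - latticePt k)) := by
  obtain ⟨g, hg⟩ := exists_torus_lift χ
  have hcoeff : ∀ n, UnitAddTorus.mFourierCoeff g n = 𝓕 (χ : Eu d → ℂ) (latticePt n) := fun n => by
    rw [UnitAddTorus.mFourierCoeff_eq_integral g n 0, fourier_eq_integral_expChar]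
    have hint : Integrable fun x => expChar (-latticePt n) x * χ x :=
      ((contDiff_expChar _).continuous.mul χ.continuous).integrable_of_hasCompactSupport
        χ.hasCompactSupport.mul_left
    rw [← setIntegral_cell_tsum hint]
    have hpre : {x : Fin d → ℝ | ∀ i, x i ∈ Ioc ((0 : Fin d → ℝ) i) ((0 : Fin d → ℝ) i + 1)} =
        (WithLp.toLp 2) ⁻¹' cell (0 : Fin d → ℤ) := by
      ext x; simp [cell]
    rw [hpre, ← (PiLp.volume_preserving_toLp (Fin d)).setIntegral_preimage_emb
      (MeasurableEquiv.toLp 2 (Fin d → ℝ)).measurableEmbedding]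
    refine integral_congr_ae (Eventually.of_forall fun x => ?_)
    dsimp only
    have e1 : UnitAddTorus.mFourier (-n) (fun i => (x i : UnitAddCircle)) = _ :=
      mFourier_torusMk (-n) x
    have e2 : g (fun i => (x i : UnitAddCircle)) = _ := hg x
    rw [e1, e2, smul_eq_mul, ← latticePt_neg]
    simp only [expChar_latticePt_add_latticePt]
    rw [tsum_mul_left, ← (Equiv.neg (Fin d → ℤ)).tsum_eq]
    simp [latticePt_neg, sub_eq_add_neg]
  have h := UnitAddTorus.hasSum_mFourier_series_apply_of_summable (f := g)
    (by
      refine Summable.of_norm ?_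
      simp only [hcoeff]
      exact summable_fourier_lattice χ) (torusMk (WithLp.ofLp x))
  rw [hg] at h
  simpa only [hcoeff, mFourier_torusMk, smul_eq_mul] using h

end Poisson

/-! ### Fourier series of periodic extensions -/

section FourierSeries

variable {d : ℕ}

/-- The Fourier coefficients of the periodic extension of `φ f` are the values at the lattice points
of the Fourier transform of `φ f`. -/
theorem hasFourierSeries_periodicExtension (φ : Test d) (f : Distrib d) :
    HasFourierSeries (periodicExtension φ f) fun n => fourierLocalized φ f (latticePt n) := by
  intro χ
  obtain ⟨S, hS⟩ := finite_periodization χ ⟨tsupport φ, φ.hasCompactSupport⟩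
  set χ' : Test d := ∑ k ∈ S, mulTest φ φ.contDiff (shiftTest (latticePt k) χ)
  have hzero : ∀ k ∉ S, mulTest φ φ.contDiff (shiftTest (latticePt k) χ) = 0 := fun k hk => by
    ext x
    rw [mulTest_apply, shiftTest_apply]
    by_cases hx : x ∈ tsupport φ
    · rw [hS x hx k hk, mul_zero]; rfl
    · rw [image_eq_zero_of_notMem_tsupport hx, zero_mul]; rfl
  have hval : periodicExtension φ f χ = f χ' := by
    rw [periodicExtension_apply, map_sum]
    refine tsum_eq_sum fun k hk => ?_
    exact (congrArg f (hzero k hk)).trans (map_zero f)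
  have hχ' : ∀ x, χ' x = φ x * ∑' k, χ (x - latticePt k) := fun x => by
    have e : χ' x = ∑ k ∈ S, φ x * χ (x - latticePt k) := by
      let ev : Test d →+ ℂ :=
        { toFun := fun θ => θ x, map_zero' := rfl, map_add' := fun _ _ => rfl }
      exact map_sum ev _ S
    rw [e, ← Finset.mul_sum]
    by_cases hx : x ∈ tsupport φ
    · rw [tsum_eq_sum fun k hk => hS x hx k hk]
    · rw [image_eq_zero_of_notMem_tsupport hx, zero_mul, zero_mul]
  have hcoef : ∀ n : Fin d → ℤ, ∫ x, expChar (latticePt n) x * χ x =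
      𝓕 (χ : Eu d → ℂ) (-latticePt n) := fun n => by
    rw [fourier_eq_integral_expChar, neg_neg]
  simp only [hcoef]
  set c : (Fin d → ℤ) → ℂ := fun n => 𝓕 (χ : Eu d → ℂ) (-latticePt n) with hc
  have hci : ∀ N : ℝ, Integrable (fun n => ‖c n‖ * bracket (-latticePt n) ^ N) Measure.count := by
    intro N
    obtain ⟨C, hC, h⟩ := exists_norm_fourier_le χ (N + (d + 1))
    refine integrable_lattice_of_decay (C := C) le_rfl fun n => ?_
    have hb := bracket_pos (-latticePt n)
    rw [Real.norm_of_nonneg (by positivity)]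
    calc _ ≤ C * bracket (-latticePt n) ^ (-(N + (d + 1))) * bracket (-latticePt n) ^ N := by
          gcongr; exact h _
      _ = _ := by rw [mul_assoc, ← Real.rpow_add hb, bracket_neg]; congr 2; ring
  obtain ⟨C, N, hC, hN, hgrow⟩ := exists_norm_fourierLocalized_le φ f
  have hprod : Integrable (fun n => c n * fourierLocalized φ f (latticePt n)) Measure.count := by
    refine ((hci N).const_mul C).mono' (measurable_of_countable _).aestronglyMeasurable
      (Eventually.of_forall fun n => ?_)
    rw [norm_mul]
    calc _ ≤ ‖c n‖ * (C * bracket (latticePt n) ^ N) := by gcongr; exact hgrow _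
      _ = _ := by rw [bracket_neg]; ring
  have hmain := apply_eq_integral_fourierLocalized f φ χ' (μ := Measure.count)
    (y := fun n : Fin d → ℤ => -latticePt n) (measurable_of_countable _) (c := c)
    (measurable_of_countable c).stronglyMeasurable hci (fun x => by
      rw [hχ' x]
      congr 1
      have hp := hasSum_poisson χ x
      have hi : Integrable (fun n => c n * expChar (-latticePt n) x) Measure.count := by
        refine integrable_count_iff.2 ?_
        simp only [norm_mul, norm_expChar, mul_one]
        simpa using integrable_count_iff.1 (hci 0)
      rw [integral_countable hi, ← hp.tsum_eq, ← (Equiv.neg (Fin d → ℤ)).tsum_eq]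
      refine tsum_congr fun n => ?_
      simp [hc, latticePt_neg, measureReal_def])
  simp only [neg_neg] at hmain
  rw [hval, hmain, integral_countable hprod]
  have hs : Summable fun n => c n * fourierLocalized φ f (latticePt n) :=
    (integrable_count_iff.1 hprod).of_norm
  simpa [measureReal_def, mul_comm] using hs.hasSum

/-- A smooth bump on `[-1, 1]` whose translates by integers form a partition of unity on `ℝ`. -/
noncomputable def lineBump (t : ℝ) : ℝ := Real.smoothTransition (t + 1) - Real.smoothTransition t

theorem lineBump_eq_zero {t : ℝ} (ht : t ∉ Icc (-1 : ℝ) 1) : lineBump t = 0 := by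
  rw [mem_Icc, not_and_or, not_le, not_le] at ht
  rcases ht with ht | ht
  · rw [lineBump, Real.smoothTransition.zero_of_nonpos (by linarith),
      Real.smoothTransition.zero_of_nonpos (by linarith), sub_zero]
  · rw [lineBump, Real.smoothTransition.one_of_one_le (by linarith),
      Real.smoothTransition.one_of_one_le (by linarith), sub_self]

theorem integral_exp_int_unitInterval (m : ℤ) :
    ∫ t in (0 : ℝ)..1, Complex.exp (2 * Real.pi * Complex.I * (m * t)) = if m = 0 then 1 else 0 := by
  split_ifs with h
  · simp [h]
  · have hc : (2 * Real.pi * Complex.I * m : ℂ) ≠ 0 := by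
      simp [h, Real.pi_ne_zero, Complex.I_ne_zero]
    have := integral_exp_mul_complex (a := 0) (b := 1) hc
    simp only [mul_assoc] at this ⊢
    rw [this]
    have e : Complex.exp (2 * (Real.pi * (Complex.I * (m * (1 : ℝ))))) = 1 :=
      Complex.exp_eq_one_iff.2 ⟨m, by push_cast; ring⟩
    rw [e]; simp

theorem integral_exp_mul_lineBump (m : ℤ) :
    ∫ t : ℝ, Complex.exp (2 * Real.pi * Complex.I * (m * t)) * (lineBump t : ℂ) =
      if m = 0 then 1 else 0 := by
  set E : ℝ → ℂ := fun t => Complex.exp (2 * Real.pi * Complex.I * (m * t)) with hE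
  have hEc : Continuous E := by fun_prop
  set h : ℝ → ℂ := fun t => (Real.smoothTransition t : ℂ) with hh
  have hhc : Continuous h := Complex.continuous_ofReal.comp Real.smoothTransition.continuous
  have hE1 : ∀ t, E (t + 1) = E t := fun t =>
    Complex.exp_eq_exp_iff_exists_int.2 ⟨m, by push_cast; ring⟩
  have h1 : ∫ t : ℝ, E t * (lineBump t : ℂ) = ∫ t in (-1 : ℝ)..1, E t * (h (t + 1) - h t) := by
    rw [intervalIntegral.integral_of_le (by norm_num), ← integral_Icc_eq_integral_Ioc,
      setIntegral_eq_integral_of_forall_compl_eq_zero]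
    · simp [lineBump, hh]
    · intro t ht
      have := lineBump_eq_zero ht
      simp only [hh]
      rw [lineBump] at this
      rw [← Complex.ofReal_sub, this]; simp
  have hi : ∀ {g : ℝ → ℂ} {a b : ℝ}, Continuous g → IntervalIntegrable g volume a b :=
    fun hg => hg.intervalIntegrable _ _
  have hc1 : Continuous fun t => E t * (h (t + 1) - h t) := by fun_prop
  have hEh : Continuous fun t => E t * h t := hEc.mul hhc
  rw [h1, ← intervalIntegral.integral_add_adjacent_intervals (b := 0) (hi hc1) (hi hc1)]
  have h2 : ∫ t in (-1 : ℝ)..0, E t * (h (t + 1) - h t) = ∫ t in (0 : ℝ)..1, E t * h t := by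
    have e : ∫ t in (-1 : ℝ)..0, E t * (h (t + 1) - h t) =
        ∫ t in (-1 : ℝ)..0, (fun t => E t * h t) (t + 1) := by
      refine intervalIntegral.integral_congr fun t ht => ?_
      rw [uIcc_of_le (by norm_num)] at ht
      have h0 : h t = 0 := by
        simp [hh, Real.smoothTransition.zero_of_nonpos ht.2]
      simp only [h0, hE1, sub_zero]
    rw [e, intervalIntegral.integral_comp_add_right (fun t => E t * h t)]
    norm_num
  have h3 : ∫ t in (0 : ℝ)..1, E t * (h (t + 1) - h t) = ∫ t in (0 : ℝ)..1, (E t - E t * h t) := by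
    refine intervalIntegral.integral_congr fun t ht => ?_
    rw [uIcc_of_le (by norm_num)] at ht
    have h0 : h (t + 1) = 1 := by
      simp [hh, Real.smoothTransition.one_of_one_le (show 1 ≤ t + 1 by linarith [ht.1])]
    simp only [h0]; ring
  rw [h2, h3, intervalIntegral.integral_sub (hi hEc) (hi hEh), add_sub_cancel]
  exact integral_exp_int_unitInterval m

/-- There is a test function whose Fourier transform restricts to the unit mass at the origin on the
integer lattice; it picks out the Fourier coefficients of periodic distributions. -/
theorem exists_test_fourier_lattice_eq_ite (d : ℕ) : ∃ ρ : Test d, ∀ n : Fin d → ℤ,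
    ∫ x, expChar (latticePt n) x * ρ x = if n = 0 then 1 else 0 := by
  have hcs : HasCompactSupport fun x : Eu d => ∏ i, ((lineBump (x i) : ℝ) : ℂ) := by
    refine HasCompactSupport.intro (isCompact_closedBall (0 : Eu d) (d + 1)) fun x hx => ?_
    by_contra hne
    refine hx ?_
    have hne' := Finset.prod_ne_zero_iff.1 hne
    have hb : ∀ i, |x i| ≤ 1 := fun i => by
      by_contra hi
      refine hne' i (Finset.mem_univ i) ?_
      rw [lineBump_eq_zero (fun h => hi (abs_le.2 ⟨h.1, h.2⟩))]; simp
    have h : ‖x‖ ^ 2 ≤ d := by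
      rw [EuclideanSpace.norm_sq_eq]
      calc ∑ i, ‖x i‖ ^ 2 ≤ ∑ _i : Fin d, (1 : ℝ) := by
            refine Finset.sum_le_sum fun i _ => ?_
            rw [Real.norm_eq_abs]
            exact pow_le_one₀ (abs_nonneg _) (hb i)
        _ = d := by simp
    rw [mem_closedBall_zero_iff]
    nlinarith [norm_nonneg x, (Nat.cast_nonneg d : (0 : ℝ) ≤ d)]
  have hsm : ContDiff ℝ ∞ fun x : Eu d => ∏ i, ((lineBump (x i) : ℝ) : ℂ) := by
    refine contDiff_prod fun i _ => ?_
    have h1 : ContDiff ℝ ∞ lineBump :=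
      (Real.smoothTransition.contDiff.comp (contDiff_id.add contDiff_const)).sub
        Real.smoothTransition.contDiff
    exact Complex.ofRealCLM.contDiff.comp (h1.comp (by fun_prop))
  refine ⟨⟨_, hsm, hcs, fun _ _ => trivial⟩, fun n => ?_⟩
  have e := (PiLp.volume_preserving_toLp (Fin d)).integral_comp
    (MeasurableEquiv.toLp 2 (Fin d → ℝ)).measurableEmbedding
    (fun x : Eu d => expChar (latticePt n) x * ∏ i, ((lineBump (x i) : ℝ) : ℂ))
  refine e.symm.trans ?_
  simp only [expChar_latticePt, ← Finset.prod_mul_distrib]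
  rw [integral_fintype_prod_volume_eq_prod
    (f := fun i (t : ℝ) => Complex.exp (2 * Real.pi * Complex.I * (n i * t)) * (lineBump t : ℂ))]
  simp only [integral_exp_mul_lineBump]
  split_ifs with h
  · simp [h]
  · obtain ⟨i, hi⟩ := Function.ne_iff.1 h
    exact Finset.prod_eq_zero (Finset.mem_univ i) (if_neg hi)

/-- The coefficients of a Fourier series converging to a distribution are unique: they are the values
of the distribution at suitable test functions. -/
theorem HasFourierSeries.exists_eq_fourierLocalized :
    ∃ ρ : Test d, ∀ (u : Distrib d) (a : (Fin d → ℤ) → ℂ), HasFourierSeries u a →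
      ∀ n, a n = fourierLocalized ρ u (latticePt n) := by
  obtain ⟨ρ, hρ⟩ := exists_test_fourier_lattice_eq_ite d
  refine ⟨ρ, fun u a ha n => ?_⟩
  have h := ha (mulTest (expChar (-latticePt n)) (contDiff_expChar _) ρ)
  have hterm : ∀ m, ∫ x, expChar (latticePt m) x *
      mulTest (expChar (-latticePt n)) (contDiff_expChar _) ρ x = if m = n then 1 else 0 :=
    fun m => by
      simp only [mulTest_apply, ← mul_assoc, ← expChar_add, ← sub_eq_add_neg, ← latticePt_sub]
      rw [hρ]
      simp only [sub_eq_zero]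
  simp only [hterm] at h
  refine HasSum.unique ?_ h
  convert hasSum_single n fun m hm => ?_ using 1
  · simp
  · simp [hm]

end FourierSeries

/-! ### Localization and the wave front set -/

section Localization

variable {d : ℕ}

theorem cube_mem_nhds {η : ℝ} (hη : 0 < η) (x : Eu d) : cube η x ∈ 𝓝 x := by
  have h : ∀ j, ∀ᶠ z : Eu d in 𝓝 x, z j ∈ Ioo (x j - η / 2) (x j + η / 2) := fun j =>
    (by fun_prop : Continuous fun z : Eu d => z j).continuousAt
      (Ioo_mem_nhds (by linarith) (by linarith))
  exact eventually_all.2 h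

theorem exists_cutoff {x : Eu d} {s : Set (Eu d)} (hs : s ∈ 𝓝 x) :
    ∃ φ : Test d, tsupport φ ⊆ s ∧ ∀ᶠ z in 𝓝 x, φ z = 1 := by
  obtain ⟨ε, hε, hball⟩ := Metric.mem_nhds_iff.1 hs
  let β : ContDiffBump x := ⟨ε / 4, ε / 2, by positivity, by linarith⟩
  have hcs : HasCompactSupport fun z => ((β z : ℝ) : ℂ) :=
    β.hasCompactSupport.comp_left (g := fun t : ℝ => (t : ℂ)) Complex.ofReal_zero
  refine ⟨⟨fun z => ((β z : ℝ) : ℂ), Complex.ofRealCLM.contDiff.comp β.contDiff, hcs,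
    fun _ _ => trivial⟩, ?_, ?_⟩
  · have h1 : tsupport (fun z => ((β z : ℝ) : ℂ)) ⊆ tsupport β :=
      closure_mono fun z hz h0 => hz (by simp only [h0, Complex.ofReal_zero])
    refine Subset.trans h1 (Subset.trans ?_ hball)
    rw [β.tsupport_eq]
    exact Metric.closedBall_subset_ball (half_lt_self hε)
  · filter_upwards [β.eventuallyEq_one] with z hz
    change ((β z : ℝ) : ℂ) = 1
    rw [hz]; simp

theorem exists_enorm_fourier_le_weight (χ : Test d) (M : ℝ) :
    ∃ C : ℝ≥0∞, C ≠ ⊤ ∧ ∀ ξ, ‖𝓕 (χ : Eu d → ℂ) ξ‖ₑ ≤ C * weight (-M) ξ := by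
  obtain ⟨C, hC, h⟩ := exists_norm_fourier_le χ M
  refine ⟨ENNReal.ofReal C, ENNReal.ofReal_ne_top, fun ξ => ?_⟩
  rw [weight, ← ENNReal.ofReal_mul hC, ← ofReal_norm]
  exact ENNReal.ofReal_le_ofReal (h ξ)

theorem exists_enorm_fourierLocalized_le_weight (φ : Test d) (f : Distrib d) :
    ∃ (C : ℝ≥0∞) (N : ℝ), C ≠ ⊤ ∧ 0 ≤ N ∧ ∀ η, ‖fourierLocalized φ f η‖ₑ ≤ C * weight N η := by
  obtain ⟨C, N, hC, hN, h⟩ := exists_norm_fourierLocalized_le φ f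
  refine ⟨ENNReal.ofReal C, N, ENNReal.ofReal_ne_top, hN, fun η => ?_⟩
  rw [weight, ← ENNReal.ofReal_mul hC, ← ofReal_norm]
  exact ENNReal.ofReal_le_ofReal (h η)

theorem enorm_sq_mul_weight (z : ℂ) (t : ℝ) (ξ : Eu d) :
    ‖z‖ₑ ^ 2 * weight t ξ = ENNReal.ofReal (‖z‖ ^ 2 * bracket ξ ^ t) := by
  rw [ENNReal.ofReal_mul (by positivity), ENNReal.ofReal_pow (norm_nonneg _), ofReal_norm]
  rfl

theorem integrableOn_iff_lintegral_lt_top {F : Eu d → ℂ} (hF : Measurable F) (t : ℝ)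
    (Γ : Set (Eu d)) :
    IntegrableOn (fun ξ => ‖F ξ‖ ^ 2 * bracket ξ ^ t) Γ ↔
      ∫⁻ ξ in Γ, ‖F ξ‖ₑ ^ 2 * weight t ξ < ⊤ := by
  have hm : Measurable fun ξ => ‖F ξ‖ ^ 2 * bracket ξ ^ t :=
    (hF.norm.pow_const 2).mul (continuous_bracket_rpow t).measurable
  rw [IntegrableOn, Integrable, and_iff_right hm.aestronglyMeasurable,
    hasFiniteIntegral_iff_ofReal (Eventually.of_forall fun ξ =>
      mul_nonneg (sq_nonneg _) (Real.rpow_nonneg (bracket_pos ξ).le _))]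
  simp only [enorm_sq_mul_weight]

theorem summable_iff_lintegral_lt_top (a : (Fin d → ℤ) → ℂ) (t : ℝ) (Γ : Set (Eu d)) :
    Summable (fun n : {n : Fin d → ℤ // latticePt n ∈ Γ} =>
        ‖a n‖ ^ 2 * bracket (latticePt (n : Fin d → ℤ)) ^ t) ↔
      ∫⁻ n in latticePt ⁻¹' Γ, ‖a n‖ₑ ^ 2 * weight t (latticePt n) ∂Measure.count < ⊤ := by
  have hpos : ∀ n, 0 ≤ ‖a n‖ ^ 2 * bracket (latticePt n) ^ t := fun n =>
    mul_nonneg (sq_nonneg _) (Real.rpow_nonneg (bracket_pos _).le _)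
  have e : ∫⁻ n in latticePt ⁻¹' Γ, ‖a n‖ₑ ^ 2 * weight t (latticePt n) ∂Measure.count =
      ∑' n : {n : Fin d → ℤ // latticePt n ∈ Γ},
        ENNReal.ofReal (‖a n‖ ^ 2 * bracket (latticePt (n : Fin d → ℤ)) ^ t) := by
    rw [← lintegral_indicator (MeasurableSet.of_discrete), lintegral_count]
    simp only [enorm_sq_mul_weight]
    exact (tsum_subtype (latticePt ⁻¹' Γ) fun n =>
      ENNReal.ofReal (‖a n‖ ^ 2 * bracket (latticePt n) ^ t)).symm
  rw [e]
  refine ⟨fun h => h.tsum_ofReal_ne_top.lt_top, fun h => ?_⟩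
  refine (ENNReal.summable_toReal h.ne).congr fun n => ?_
  exact ENNReal.toReal_ofReal (hpos n)

/-- If `ψ = 1` on the support of `φ`, then the Fourier transform of `φ f` is the convolution of the
Fourier transforms of `φ` and of `ψ f`, by Fourier inversion for `φ`. -/
theorem enorm_fourierLocalized_le_convolution {φ ψ : Test d} (h : ∀ x ∈ tsupport φ, ψ x = 1)
    (f : Distrib d) (η : Eu d) :
    ‖fourierLocalized φ f η‖ₑ ≤
      ∫⁻ ξ, ‖𝓕 (φ : Eu d → ℂ) (η - ξ)‖ₑ * ‖fourierLocalized ψ f ξ‖ₑ := by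
  have key : fourierLocalized φ f η =
      ∫ ζ, 𝓕 (φ : Eu d → ℂ) ζ * fourierLocalized ψ f (-(ζ - η)) := by
    refine apply_eq_integral_fourierLocalized f ψ _ (y := fun ζ => ζ - η) (by fun_prop)
      (continuous_fourier_test φ).stronglyMeasurable (fun N => ?_) fun x => ?_
    · refine ((integrable_bracket_mul_fourier φ N).const_mul
        (2 ^ |N| * bracket (-η) ^ |N|)).mono' ?_ (Eventually.of_forall fun ζ => ?_)
      · exact ((continuous_fourier_test φ).norm.mul ((continuous_bracket_rpow N).comp
          (continuous_id.sub continuous_const))).aestronglyMeasurable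
      · have hb := bracket_pos (ζ - η)
        rw [Real.norm_of_nonneg (by positivity)]
        have hp := bracket_rpow_le N (ζ - η) ζ
        rw [sub_sub_cancel_left] at hp
        calc _ ≤ ‖𝓕 (φ : Eu d → ℂ) ζ‖ * (2 ^ |N| * bracket ζ ^ N * bracket (-η) ^ |N|) := by
              gcongr
          _ = _ := by ring
    · have hinv : ∫ ζ, 𝓕 (φ : Eu d → ℂ) ζ * expChar (ζ - η) x = expChar (-η) x * φ x := by
        rw [fourierInv_fourier_test φ x, ← integral_const_mul]
        refine integral_congr_ae (Eventually.of_forall fun ζ => ?_)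
        simp only [sub_eq_add_neg, expChar_add]; ring
      rw [mulTest_apply, hinv]
      by_cases hx : x ∈ tsupport φ
      · rw [h x hx, one_mul]
      · rw [image_eq_zero_of_notMem_tsupport hx]; ring
  rw [key]
  refine (enorm_integral_le_lintegral_enorm _).trans (le_of_eq ?_)
  rw [← lintegral_sub_left_eq_self _ η]
  simp [enorm_mul]

/-- If `φ` is supported in a cube of side less than one and `φ = 1` on the support of `χ`, which
lies in the same cube, then `(φ f)_p` and `f` agree on `χ`, as the integer translates of the cube
are disjoint. -/
theorem periodicExtension_apply_eq {η : ℝ} (hη : η < 1) {x₀ : Eu d} {φ χ : Test d}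
    (hφ : tsupport φ ⊆ cube η x₀) (hχ : tsupport χ ⊆ cube η x₀) (h : ∀ x ∈ tsupport χ, φ x = 1)
    (f : Distrib d) : periodicExtension φ f χ = f χ := by
  have hzero : ∀ n : Fin d → ℤ, n ≠ 0 →
      mulTest φ φ.contDiff (shiftTest (latticePt n) χ) = 0 := fun n hn => by
    ext x
    rw [mulTest_apply, shiftTest_apply]
    by_contra hne
    have hx := hφ (subset_tsupport _ (left_ne_zero_of_mul hne))
    have hx' := hχ (subset_tsupport _ (right_ne_zero_of_mul hne))
    refine hn (funext fun j => ?_)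
    have h1 := hx j
    have h2 := hx' j
    have e : (x - latticePt n) j = x j - n j := rfl
    rw [e] at h2
    have h3 : (n j : ℝ) < 1 := by linarith [h1.2, h2.1]
    have h4 : (-1 : ℝ) < n j := by linarith [h1.1, h2.2]
    have h3' : n j < 1 := by exact_mod_cast h3
    have h4' : -1 < n j := by exact_mod_cast h4
    simp only [Pi.zero_apply]; omega
  have hone : mulTest φ φ.contDiff (shiftTest (latticePt 0) χ) = χ := by
    ext x
    have e : x - latticePt (0 : Fin d → ℤ) = x := by ext i; simp [latticePt]
    rw [mulTest_apply, shiftTest_apply, e]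
    by_cases hx : x ∈ tsupport χ
    · rw [h x hx, one_mul]
    · rw [image_eq_zero_of_notMem_tsupport hx, mul_zero]
  rw [periodicExtension_apply]
  refine (tsum_eq_single 0 fun n hn => ?_).trans (congrArg f hone)
  exact (congrArg f (hzero n hn)).trans (map_zero f)

theorem enorm_fourierLocalized_le_tsum {η : ℝ} (hη : η < 1) {x₀ : Eu d} {φ ψ : Test d}
    (hφ : tsupport φ ⊆ cube η x₀) (hψ : tsupport ψ ⊆ cube η x₀) (h : ∀ x ∈ tsupport ψ, φ x = 1)
    {f : Distrib d} {a : (Fin d → ℤ) → ℂ} (ha : HasFourierSeries (periodicExtension φ f) a)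
    (ξ : Eu d) :
    ‖fourierLocalized ψ f ξ‖ₑ ≤ ∑' n, ‖𝓕 (ψ : Eu d → ℂ) (ξ - latticePt n)‖ₑ * ‖a n‖ₑ := by
  have hsub := tsupport_mulTest_subset (expChar (-ξ)) (contDiff_expChar _) ψ
  have hs := ha (mulTest (expChar (-ξ)) (contDiff_expChar _) ψ)
  rw [periodicExtension_apply_eq hη hφ (hsub.trans hψ) (fun x hx => h x (hsub hx))] at hs
  have hterm : ∀ n, ∫ x, expChar (latticePt n) x *
      mulTest (expChar (-ξ)) (contDiff_expChar _) ψ x = 𝓕 (ψ : Eu d → ℂ) (ξ - latticePt n) :=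
    fun n => by
      rw [fourier_eq_integral_expChar]
      simp only [mulTest_apply, ← mul_assoc, ← expChar_add]
      congr! 4
      abel
  simp only [hterm] at hs
  rw [fourierLocalized, ← hs.tsum_eq]
  refine enorm_tsum_le_tsum_enorm.trans (le_of_eq (tsum_congr fun n => ?_))
  rw [enorm_mul, mul_comm]

/-- Square integrability on a cone of the Fourier transform of one localization of `f` gives square
summability on a narrower cone of the Fourier coefficients of another. -/
theorem MicrolocallyRegular.exists_hasFourierSeries {f : Distrib d} {s : ℝ} {x₀ ξ₀ : Eu d}
    (hreg : MicrolocallyRegular s f x₀ ξ₀) :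
    ∃ (Γ : Set (Eu d)) (η : ℝ) (φ : Test d) (a : (Fin d → ℤ) → ℂ),
      IsOpenCone Γ ∧ ξ₀ ∈ Γ ∧ 0 < η ∧ η < 1 ∧ tsupport φ ⊆ cube η x₀ ∧
      (∀ᶠ x in 𝓝 x₀, φ x = 1) ∧ HasFourierSeries (periodicExtension φ f) a ∧
      Summable (fun n : {n : Fin d → ℤ // latticePt n ∈ Γ} =>
        ‖a n‖ ^ 2 * bracket (latticePt (n : Fin d → ℤ)) ^ (2 * s)) := by
  obtain ⟨Γ, ψ, hΓ, hξΓ, hψ, hint⟩ := hreg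
  obtain ⟨φ, hφs, hφ1⟩ := exists_cutoff (inter_mem hψ (cube_mem_nhds (half_pos one_pos) x₀))
  obtain ⟨D, N, hD, hN, hgrow⟩ := exists_enorm_fourierLocalized_le_weight ψ f
  have hmeas := measurable_fourierLocalized ψ f
  have hF : ∫⁻ ξ in id ⁻¹' Γ, ‖fourierLocalized ψ f ξ‖ₑ ^ 2 * weight (2 * s) (id ξ) < ⊤ :=
    (integrableOn_iff_lintegral_lt_top hmeas (2 * s) Γ).1 hint
  have hconv : ∀ n : Fin d → ℤ, ‖fourierLocalized φ f (latticePt n)‖ₑ ≤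
      ∫⁻ ξ, ‖𝓕 (φ : Eu d → ℂ) (latticePt n - id ξ)‖ₑ * ‖fourierLocalized ψ f ξ‖ₑ := fun n =>
    enorm_fourierLocalized_le_convolution (fun x hx => (hφs hx).1) f (latticePt n)
  obtain ⟨Γ', hΓ', hξΓ', hfin⟩ := exists_cone_lintegral_sq_lt_top boundedDensity_volume
    boundedDensity_lattice (k := fun ξ => ‖𝓕 (φ : Eu d → ℂ) ξ‖ₑ)
    (F := fun ξ => ‖fourierLocalized ψ f ξ‖ₑ)
    (G := fun n => ‖fourierLocalized φ f (latticePt n)‖ₑ)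
    (continuous_fourier_test φ).enorm.measurable
    (exists_enorm_fourier_le_weight φ) hmeas.enorm hN hD hgrow hconv hΓ hξΓ s hF
  have hsum := (summable_iff_lintegral_lt_top (fun n => fourierLocalized φ f (latticePt n))
    (2 * s) Γ').2 hfin
  have hcube : tsupport φ ⊆ cube (1 / 2) x₀ := fun x hx => (hφs hx).2
  exact ⟨Γ', 1 / 2, φ, fun n => fourierLocalized φ f (latticePt n), hΓ', hξΓ', half_pos one_pos,
    one_half_lt_one, hcube, hφ1, hasFourierSeries_periodicExtension φ f, hsum⟩

/-- Square summability on a cone of the Fourier coefficients of a periodic extension of `φ f` gives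
square integrability on a narrower cone of the Fourier transform of another localization of `f`. -/
theorem MicrolocallyRegular.of_hasFourierSeries {f : Distrib d} {s : ℝ} {x₀ ξ₀ : Eu d}
    {Γ : Set (Eu d)} {η : ℝ} {φ : Test d} {a : (Fin d → ℤ) → ℂ} (hΓ : IsOpenCone Γ) (hξΓ : ξ₀ ∈ Γ)
    (hη0 : 0 < η) (hη1 : η < 1) (hφs : tsupport φ ⊆ cube η x₀) (hφ1 : ∀ᶠ x in 𝓝 x₀, φ x = 1)
    (ha : HasFourierSeries (periodicExtension φ f) a)
    (hsum : Summable (fun n : {n : Fin d → ℤ // latticePt n ∈ Γ} =>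
      ‖a n‖ ^ 2 * bracket (latticePt (n : Fin d → ℤ)) ^ (2 * s))) :
    MicrolocallyRegular s f x₀ ξ₀ := by
  obtain ⟨ψ, hψs, hψ1⟩ := exists_cutoff (inter_mem hφ1 (cube_mem_nhds hη0 x₀))
  -- the coefficients have polynomial growth, being the values at the lattice points of the Fourier
  -- transform of a localization of the periodic extension
  obtain ⟨ρ, hρ⟩ := HasFourierSeries.exists_eq_fourierLocalized (d := d)
  obtain ⟨D, N, hD, hN, hgrow⟩ :=
    exists_enorm_fourierLocalized_le_weight ρ (periodicExtension φ f)
  have hagrow : ∀ n, ‖a n‖ₑ ≤ D * weight N (latticePt n) := fun n => by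
    rw [hρ _ a ha n]; exact hgrow _
  have hconv : ∀ ξ : Eu d, ‖fourierLocalized ψ f ξ‖ₑ ≤
      ∫⁻ n, ‖𝓕 (ψ : Eu d → ℂ) (id ξ - latticePt n)‖ₑ * ‖a n‖ₑ ∂Measure.count := fun ξ => by
    rw [lintegral_count]
    exact enorm_fourierLocalized_le_tsum hη1 hφs (fun x hx => (hψs hx).2)
      (fun x hx => (hψs hx).1) ha ξ
  obtain ⟨Γ', hΓ', hξΓ', hfin⟩ := exists_cone_lintegral_sq_lt_top boundedDensity_lattice
    boundedDensity_volume (k := fun ξ => ‖𝓕 (ψ : Eu d → ℂ) ξ‖ₑ)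
    (continuous_fourier_test ψ).enorm.measurable
    (exists_enorm_fourier_le_weight ψ) (measurable_of_countable fun n => ‖a n‖ₑ) hN hD
    hagrow hconv hΓ hξΓ s ((summable_iff_lintegral_lt_top a (2 * s) Γ).1 hsum)
  exact ⟨Γ', ψ, hΓ', hξΓ', hψ1,
    (integrableOn_iff_lintegral_lt_top (measurable_fourierLocalized ψ f) (2 * s) Γ').2 hfin⟩

end Localization

end SobolevWF

theorem theorem3p2 {d : ℕ} (f : SobolevWF.Distrib d) (s : ℝ) (x₀ ξ₀ : SobolevWF.Eu d)
    (hξ₀ : ξ₀ ≠ 0) :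
    (x₀, ξ₀) ∉ SobolevWF.WFs s f ↔
      ∃ (Γ : Set (SobolevWF.Eu d)) (η : ℝ) (φ : SobolevWF.Test d) (a : (Fin d → ℤ) → ℂ),
        SobolevWF.IsOpenCone Γ ∧ ξ₀ ∈ Γ ∧
        0 < η ∧ η < 1 ∧ tsupport φ ⊆ SobolevWF.cube η x₀ ∧
        (∀ᶠ x in 𝓝 x₀, φ x = 1) ∧
        SobolevWF.HasFourierSeries (SobolevWF.periodicExtension φ f) a ∧
        Summable (fun n : {n : Fin d → ℤ // SobolevWF.latticePt n ∈ Γ} =>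
          ‖a n‖ ^ 2 * SobolevWF.bracket (SobolevWF.latticePt (n : Fin d → ℤ)) ^ (2 * s)) := by
  have hWF : (x₀, ξ₀) ∉ SobolevWF.WFs s f ↔ SobolevWF.MicrolocallyRegular s f x₀ ξ₀ := by
    simp [SobolevWF.WFs, hξ₀]
  rw [hWF]
  constructor
  · exact SobolevWF.MicrolocallyRegular.exists_hasFourierSeries
  · rintro ⟨Γ, η, φ, a, hΓ, hξΓ, hη0, hη1, hφs, hφ1, ha, hsum⟩
    exact SobolevWF.MicrolocallyRegular.of_hasFourierSeries hΓ hξΓ hη0 hη1 hφs hφ1 ha hsum
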